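/- Conventions. For a sequence $S(N)$ having, as $N\to\infty$, an asymptotic expansion in terms $N^{\alpha}(\log N)^{l}$ ($\alpha\in\mathbb C$, $l\in\mathbb N$), let $\mathrm{fp}_{N\to\infty}S(N)$ be its constant term. For functions $f_1,\dots,f_k:\mathbb R\to\mathbb C$ the *cut-off nested sum* of $f_1\otimes\cdots\otimes f_k$ is $$\mathrm{fp}_{N\to\infty}\sum_{0<n_k<\cdots<n_1\le N} f_1(n_1)\cdots f_k(n_k),$$ extended linearly to tensors. For a composition $I=(i_1,\dots,i_r)$ of $n$ let $$I[f_1\otimes\cdots\otimes f_n]=(f_1\cdots f_{i_1})\otimes(f_{i_1+1}\cdots f_{i_1+i_2})\otimes\cdots\otimes(f_{i_1+\cdots+i_{r-1}+1}\cdots f_n)$$ (pointwise products). Hoffman's isomorphism and its inverse are the linear maps $$\exp(u)=\sum_{I}\frac{1}{i_1!\cdots i_r!}\,I[u],\qquad \log(u)=\sum_{I}\frac{(-1)^{n-r}}{i_1\cdots i_r}\,I[u]\qquad(u=f_1\otimes\cdots\otimes f_n),$$ the sums running over all compositions $I=(i_1,\dots,i_r)$ of $n$. Let $v\ge 0$ be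 real, let $\gamma$ be holomorphic near $0\in\mathbb C$ with $\gamma(0)=0$ and $\gamma'(0)=1$, and let $\chi$ be a smooth cut-off function on $\mathbb R$ which vanishes on $]-\infty,\varepsilon[$ for some $\varepsilon>0$ and equals $1$ on $[1,\infty[$. The shifted Riesz regularisation is $\mathcal R_v(\tau)(z)(\xi)=\tau(\xi)(\xi+v)^{-\gamma(z)}$. Let $\widetilde{\mathcal R}_v(z)$ be its extension $f_1\otimes\cdots\otimes f_k\mapsto \mathcal R_v(f_1)(z)\otimes\cdots\otimes\mathcal R_v(f_k)(z)$ to tensors, and put $\widetilde{\mathcal R}_v^{\star}(z)=\exp\circ\widetilde{\mathcal R}_v(z)\circ\log$. For nonnegative integers $a_1,\dots,a_k$ let $\sigma^v=\sigma^v_{-a_1}\otimes\cdots\otimes\sigma^v_{-a_k}$, where $\sigma^v_{s}(\xi)=\chi(\xi)(\xi+v)^{-s}$. The *renormalised Hurwitz multiple zeta value* $\zeta(-a_1,\dots,-a_k;v)$ is $\Psi_+(\sigma^v)(0)$. Here $\Psi(\sigma)(z)$ is the cut-off nested sum of $\widetilde{\mathcal R}_v^{\star}(z)(\sigma)$, and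 $\Psi_\pm$ is its Birkhoff decomposition for the deconcatenation coproduct and minimal subtraction: on pure tensors of positive degree $$\Psi_-(\sigma)=-\pi\Big[\Psi(\sigma)+\sum\Psi_-(\sigma')\Psi(\sigma'')\Big],\qquad \Psi_+(\sigma)=(1-\pi)\Big[\Psi(\sigma)+\sum\Psi_-(\sigma')\Psi(\sigma'')\Big],$$ where the sums run over the splittings $\sigma=\sigma'\otimes\sigma''$ into factors of positive degree, $\pi$ is the projection of a Laurent series at $0$ onto its pole part in $z^{-1}\mathbb C[z^{-1}]$, and $\Psi_\pm(1)=1$. **Theorem.** For all nonnegative integers $a_1,\dots,a_k$ there is a polynomial $P$ with rational coefficients, of degree exactly $k+a_1+\cdots+a_k$, depending only on $a_1,\dots,a_k$, such that for all $v\ge 0$, $\chi$ and $\gamma$ as above: 1. for every $z\ne 0$ close enough to $0$ the cut-off nested sum of $\widetilde{\mathcal R}_v^{\star}(z)(\sigma^v)$ exists, and as a function of $z$ it extends holomorphically to $z=0$; 2. the value at $z=0$ of this extension, i.e. the limit as $z\to0$ of the cut-off nested sums, is $P(v)$, and the renormalised value is the same number: $\zeta(-a_1,\dots,-a_k;v)=P(v)$.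 In particular $\zeta(-a_1,\dots,-a_k;v)$ is a polynomial in $v$ of degree $k+a_1+\cdots+a_k$ with rational coefficients independent of $\gamma$, and the renormalised multiple zeta values $\zeta(-a_1,\dots,-a_k)=\zeta(-a_1,\dots,-a_k;0)$ at nonpositive integers are rational numbers. -/

import Mathlib

open Filter Topology Polynomial
open scoped TensorProduct DirectSum

/-! ### The tensor algebra as a direct sum of tensor powers, and Hoffman's maps -/

/-- The underlying space `⨁ₖ A^{⊗k}` of the tensor algebra of `A`. -/
abbrev Tensors (A : Type*) [CommRing A] [Algebra ℂ A] : Type _ := ⨁ k : ℕ, ⨂[ℂ]^k A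

section Hoffman

variable {A : Type*} [CommRing A]

/-- The product of the entries of `v` lying in the `j`-th block of the composition `I`. -/
def blockProd {n : ℕ} (I : Composition n) (v : Fin n → A) (j : Fin I.length) : A :=
  ∏ i ∈ Finset.univ.filter (fun i => I.index i = j), v i

theorem blockProd_update {n : ℕ} (I : Composition n) (v : Fin n → A) (i : Fin n) (x : A) :
    blockProd I (Function.update v i x) =
      Function.update (blockProd I v) (I.index i)
        (x * ∏ l ∈ (Finset.univ.filter (fun l => I.index l = I.index i)).erase i, v l) := by
  funext j
  by_cases h : j = I.index i
  · subst h
    rw [Function.update_self, blockProd,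
      ← Finset.mul_prod_erase (Finset.univ.filter (fun l => I.index l = I.index i)) _
        (a := i) (by simp), Function.update_self]
    congr 1
    refine Finset.prod_congr rfl fun l hl => ?_
    rw [Function.update_of_ne (Finset.ne_of_mem_erase hl)]
  · rw [Function.update_of_ne h]
    refine Finset.prod_congr rfl fun l hl => ?_
    rw [Function.update_of_ne]
    rintro rfl
    exact h (Finset.mem_filter.mp hl).2.symm

variable [Algebra ℂ A]

/-- The pure tensor `v₁ ⊗ ⋯ ⊗ vₖ` in `⨁ₖ A^{⊗k}`. -/
noncomputable def pureTensor {k : ℕ} (v : Fin k → A) : Tensors A :=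
  DirectSum.lof ℂ ℕ (fun k => ⨂[ℂ]^k A) k (PiTensorProduct.tprod ℂ v)

/-- For a composition `I = (i₁, …, iₖ)` of `n`, the map
`v₁ ⊗ ⋯ ⊗ vₙ ↦ I[v₁ ⊗ ⋯ ⊗ vₙ] = (v₁ ⋯ v_{i₁}) ⊗ (v_{i₁+1} ⋯ v_{i₁+i₂}) ⊗ ⋯`,
as a multilinear map. -/
noncomputable def contractBlocks {n : ℕ} (I : Composition n) :
    MultilinearMap ℂ (fun _ : Fin n => A) (Tensors A) where
  toFun v := pureTensor (blockProd I v)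
  map_update_add' := by
    intro inst v i x y
    have e : inst = instDecidableEqFin n := Subsingleton.elim _ _
    subst e
    simp only [blockProd_update, add_mul, pureTensor, MultilinearMap.map_update_add, map_add]
  map_update_smul' := by
    intro inst v i c x
    have e : inst = instDecidableEqFin n := Subsingleton.elim _ _
    subst e
    simp only [blockProd_update, smul_mul_assoc, pureTensor, MultilinearMap.map_update_smul,
      map_smul]

/-- Hoffman's exponential:
`exp (v₁ ⊗ ⋯ ⊗ vₙ) = ∑_I 1 / (i₁! ⋯ iₖ!) • I[v₁ ⊗ ⋯ ⊗ vₙ]`,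
the sum being over the compositions `I = (i₁, …, iₖ)` of `n`. -/
noncomputable def hoffmanExp : Tensors A →ₗ[ℂ] Tensors A :=
  DirectSum.toModule ℂ ℕ (Tensors A) fun n =>
    ∑ I : Composition n,
      (1 / ∏ j : Fin I.length, ((I.blocksFun j).factorial : ℂ)) •
        PiTensorProduct.lift (contractBlocks (A := A) I)

/-- Hoffman's logarithm:
`log (v₁ ⊗ ⋯ ⊗ vₙ) = ∑_I (-1)ⁿ⁻ᵏ / (i₁ ⋯ iₖ) • I[v₁ ⊗ ⋯ ⊗ vₙ]`,
the sum being over the compositions `I = (i₁, …, iₖ)` of `n` (so `k ≤ n`). -/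
noncomputable def hoffmanLog : Tensors A →ₗ[ℂ] Tensors A :=
  DirectSum.toModule ℂ ℕ (Tensors A) fun n =>
    ∑ I : Composition n,
      ((-1) ^ (n - I.length) / ∏ j : Fin I.length, (I.blocksFun j : ℂ)) •
        PiTensorProduct.lift (contractBlocks (A := A) I)

/-- The extension of a linear map `R` on `A` to tensors,
`v₁ ⊗ ⋯ ⊗ vₖ ↦ R v₁ ⊗ ⋯ ⊗ R vₖ`. -/
noncomputable def tensorMap (R : A →ₗ[ℂ] A) : Tensors A →ₗ[ℂ] Tensors A :=
  DirectSum.lmap fun k => PiTensorProduct.map fun _ : Fin k => R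

/-- The extension of `R` twisted by Hoffman's isomorphism, `exp ∘ R̃ ∘ log`. -/
noncomputable def twistedMap (R : A →ₗ[ℂ] A) : Tensors A →ₗ[ℂ] Tensors A :=
  hoffmanExp ∘ₗ tensorMap R ∘ₗ hoffmanLog

end Hoffman

/-! ### Finite parts and cut-off nested sums -/

/-- `c` is the constant term of an asymptotic expansion, as `N → ∞`, of the sequence `S` in terms
`N ^ α * (log N) ^ l` with `α` complex and `l` a natural number. (Only the finitely many terms
that do not tend to `0` matter for the constant term.) -/
def HasFinitePart (S : ℕ → ℂ) (c : ℂ) : Prop :=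
  ∃ (s : Finset (ℂ × ℕ)) (b : ℂ × ℕ → ℂ), (0, 0) ∉ s ∧
    Tendsto (fun N : ℕ =>
      S N - c - ∑ p ∈ s, b p * (N : ℂ) ^ p.1 * ((Real.log N : ℝ) : ℂ) ^ p.2) atTop (𝓝 0)

open Classical in
/-- The finite part (constant term of the asymptotic expansion) of `S N` as `N → ∞`; it is `0` by
convention if there is no such expansion. -/
noncomputable def finitePart (S : ℕ → ℂ) : ℂ :=
  if h : ∃ c, HasFinitePart S c then h.choose else 0

theorem exists_natCast_cpow_ne_one {α : ℂ} (hα : α ≠ 0) : ∃ m : ℕ, 0 < m ∧ (m : ℂ) ^ α ≠ 1 := by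
  by_contra! H
  have key : ∀ m : ℕ, 2 ≤ m → ∃ n : ℤ, n ≠ 0 ∧
      (Real.log m : ℂ) * α = n * (2 * Real.pi * Complex.I) := by
    intro m hm
    have h1 := H m (by omega)
    rw [Complex.cpow_def_of_ne_zero (by norm_cast; omega), Complex.natCast_log.symm,
      Complex.exp_eq_one_iff] at h1
    obtain ⟨n, hn⟩ := h1
    refine ⟨n, ?_, hn⟩
    rintro rfl
    have h2 : (Real.log m : ℂ) ≠ 0 :=
      Complex.ofReal_ne_zero.mpr (Real.log_pos (by exact_mod_cast hm)).ne'
    exact mul_ne_zero h2 hα (by rw [hn]; simp)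
  obtain ⟨a, ha0, ha⟩ := key 2 le_rfl
  obtain ⟨b, -, hb⟩ := key 3 (by norm_num)
  have hpi : (2 * Real.pi * Complex.I : ℂ) ≠ 0 := Complex.two_pi_I_ne_zero
  have h2 : (a : ℂ) * Real.log (3 : ℕ) = b * Real.log (2 : ℕ) := by
    apply mul_right_cancel₀ hpi
    linear_combination ((Real.log (2 : ℕ) : ℝ) : ℂ) * hb - ((Real.log (3 : ℕ) : ℝ) : ℂ) * ha
  have h3 : (a : ℝ) * Real.log (3 : ℕ) = b * Real.log (2 : ℕ) := by exact_mod_cast h2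
  have l2 : 0 < Real.log (2 : ℕ) := Real.log_pos (by norm_num)
  have l3 : 0 < Real.log (3 : ℕ) := Real.log_pos (by norm_num)
  have h4 : (a.natAbs : ℝ) * Real.log (3 : ℕ) = b.natAbs * Real.log (2 : ℕ) := by
    have := congrArg abs h3
    rwa [abs_mul, abs_mul, abs_of_pos l2, abs_of_pos l3, ← Int.cast_abs, ← Int.cast_abs,
      Int.abs_eq_natAbs, Int.abs_eq_natAbs, Int.cast_natCast, Int.cast_natCast] at this
  rw [← Real.log_pow, ← Real.log_pow] at h4
  have h5 := Real.log_injOn_pos (by simp) (by simp) h4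
  have h6 : 3 ^ a.natAbs = 2 ^ b.natAbs := by exact_mod_cast h5
  have h7 : ¬ 2 ∣ 3 ^ a.natAbs := fun h => by
    have := Nat.prime_two.dvd_of_dvd_pow h
    omega
  rcases Nat.eq_zero_or_pos b.natAbs with hb0 | hb0
  · rw [hb0, pow_zero, Nat.pow_eq_one] at h6
    omega
  · exact h7 (h6 ▸ dvd_pow_self 2 hb0.ne')

theorem eq_zero_of_tendsto_log_expansion (S : Finset ℂ) :
    0 ∉ S → ∀ (P : ℂ[X]) (Q : ℂ → ℂ[X]),
    Tendsto (fun N : ℕ => P.eval ((Real.log N : ℝ) : ℂ) +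
      ∑ α ∈ S, (Q α).eval ((Real.log N : ℝ) : ℂ) * (N : ℂ) ^ α) atTop (𝓝 0) → P = 0 := by
  induction S using Finset.induction_on with
  | empty =>
    intro _ P _ h
    simp only [Finset.sum_empty, add_zero] at h
    rcases lt_or_ge 0 P.degree with hd | hd
    · have h1 : Tendsto (fun N : ℕ => ‖((Real.log N : ℝ) : ℂ)‖) atTop atTop := by
        simp only [Complex.norm_real]
        exact tendsto_norm_atTop_atTop.comp (Real.tendsto_log_atTop.comp tendsto_natCast_atTop_atTop)
      exact absurd h.norm (not_tendsto_nhds_of_tendsto_atTop (P.tendsto_norm_atTop hd h1) _)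
    · rw [eq_C_of_degree_le_zero hd] at h ⊢
      simp only [eval_C] at h
      rw [tendsto_nhds_unique tendsto_const_nhds h, C_0]
  | insert β S hβ ih =>
    intro h0 P Q h
    simp only [Finset.mem_insert, not_or] at h0
    obtain ⟨m, hm, hmβ⟩ := exists_natCast_cpow_ne_one (Ne.symm h0.1)
    have main : ∀ (d : ℕ) (P : ℂ[X]) (Q : ℂ → ℂ[X]), (Q β).degree < d →
        Tendsto (fun N : ℕ => P.eval ((Real.log N : ℝ) : ℂ) +
          ∑ α ∈ insert β S, (Q α).eval ((Real.log N : ℝ) : ℂ) * (N : ℂ) ^ α) atTop (𝓝 0) →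
        P = 0 := by
      intro d
      induction d with
      | zero =>
        intro P Q hQ h
        refine ih h0.2 P Q ?_
        have : Q β = 0 := by
          rw [← degree_eq_bot, ← Nat.WithBot.lt_zero_iff]; exact_mod_cast hQ
        simpa [Finset.sum_insert hβ, this] using h
      | succ d ihd =>
        intro P Q hQ h
        set r : ℂ := ((Real.log m : ℝ) : ℂ) with hr
        have hz : ∀ α : ℂ, (m : ℂ) ^ α ≠ 0 := fun α => by
          rw [Ne, Complex.cpow_eq_zero_iff]; simp; omega
        have h1 := ihd (taylor r P - C ((m : ℂ) ^ β) * P)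
          (fun α => C ((m : ℂ) ^ α) * taylor r (Q α) - C ((m : ℂ) ^ β) * Q α) ?_ ?_
        · by_contra hP
          have h2 := congrArg (fun p => p.coeff P.natDegree) h1
          have h3 : (taylor r P).coeff P.natDegree = P.leadingCoeff := by
            rw [← leadingCoeff_taylor r, leadingCoeff, natDegree_taylor]
          simp only [coeff_sub, coeff_C_mul, coeff_zero, h3, coeff_natDegree] at h2
          have h4 : (1 - (m : ℂ) ^ β) * P.leadingCoeff = 0 := by linear_combination h2
          rcases mul_eq_zero.mp h4 with h5 | h5
          · exact hmβ (sub_eq_zero.mp h5).symm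
          · exact hP (leadingCoeff_eq_zero.mp h5)
        · by_cases hq : Q β = 0
          · simp [hq]
          · rw [← mul_sub, degree_C_mul (hz β)]
            refine lt_of_lt_of_le (degree_sub_lt_left (degree_taylor _ _) (by simpa using hq)
              (leadingCoeff_taylor _ _)) ?_
            rw [degree_taylor]
            rw [degree_eq_natDegree hq] at hQ ⊢
            have hQ' : (Q β).natDegree < d + 1 := by exact_mod_cast hQ
            exact_mod_cast Nat.lt_succ_iff.mp hQ'
        · have h5 : Tendsto (fun N : ℕ => m * N) atTop atTop :=
            tendsto_id.const_mul_atTop' hm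
          have h6 := (h.comp h5).sub (h.const_mul ((m : ℂ) ^ β))
          simp only [mul_zero, sub_zero] at h6
          refine h6.congr' ?_
          filter_upwards [eventually_ge_atTop 1] with N hN
          have h7 : ((Real.log ((m * N : ℕ) : ℝ) : ℝ) : ℂ) = ((Real.log N : ℝ) : ℂ) + r := by
            rw [Nat.cast_mul, Real.log_mul (by positivity) (by positivity), hr]
            push_cast; ring
          have h8 : ∀ α : ℂ, ((m * N : ℕ) : ℂ) ^ α = (m : ℂ) ^ α * (N : ℂ) ^ α := fun α => by
            rw [Nat.cast_mul, Complex.natCast_mul_natCast_cpow]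
          simp only [Function.comp_apply, h7, h8, eval_sub, eval_mul, eval_C, taylor_eval]
          rw [mul_add, Finset.mul_sum, add_sub_add_comm, ← Finset.sum_sub_distrib]
          congr 1
          exact Finset.sum_congr rfl fun α _ => by ring
    rcases eq_or_ne (Q β) 0 with hq | hq
    · exact main 0 P Q (by simp [hq]) h
    · exact main ((Q β).natDegree + 1) P Q
        (by rw [degree_eq_natDegree hq]; exact_mod_cast Nat.lt_succ_self _) h

/-- The constant term of an asymptotic expansion is unique. -/
theorem HasFinitePart.unique {S : ℕ → ℂ} {c c' : ℂ} (h : HasFinitePart S c)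
    (h' : HasFinitePart S c') : c = c' := by
  classical
  obtain ⟨s, b, hs, h⟩ := h
  obtain ⟨s', b', hs', h'⟩ := h'
  set a : ℂ × ℕ → ℂ := fun p =>
    (if p ∈ s then b p else 0) - (if p ∈ s' then b' p else 0) with ha
  set T : Finset (ℂ × ℕ) := s ∪ s' with hT
  set Q : ℂ → ℂ[X] := fun α => ∑ p ∈ T.filter (fun p => p.1 = α), C (a p) * X ^ p.2 with hQ
  set U : Finset ℂ := (T.image Prod.fst).erase 0 with hU
  have key := eq_zero_of_tendsto_log_expansion U (by simp [hU]) (C (c - c') + Q 0) Q ?_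
  · have h1 := congrArg (fun p => p.coeff 0) key
    have h2 : (Q 0).coeff 0 = 0 := by
      rw [hQ, finsetSum_coeff]
      refine Finset.sum_eq_zero fun p hp => ?_
      rw [coeff_C_mul, coeff_X_pow, if_neg, mul_zero]
      intro h3
      obtain ⟨hp1, hp2⟩ := Finset.mem_filter.mp hp
      have h4 : p = (0, 0) := Prod.ext hp2 h3.symm
      rw [h4, hT, Finset.mem_union] at hp1
      exact hp1.elim hs hs'
    simp only [coeff_add, coeff_C_zero, h2, add_zero, coeff_zero] at h1
    exact sub_eq_zero.mp h1
  · have h1 := h'.sub h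
    rw [sub_zero] at h1
    refine h1.congr' ?_
    filter_upwards [eventually_ge_atTop 1] with N hN
    set t : ℂ × ℕ → ℂ := fun p => (N : ℂ) ^ p.1 * ((Real.log N : ℝ) : ℂ) ^ p.2 with ht
    have e1 : ∑ p ∈ s, b p * (N : ℂ) ^ p.1 * ((Real.log N : ℝ) : ℂ) ^ p.2 =
        ∑ p ∈ T, (if p ∈ s then b p else 0) * t p := by
      simp only [ite_mul, zero_mul, ← Finset.sum_filter, ht, mul_assoc]
      refine Finset.sum_congr ?_ fun _ _ => rfl
      ext p; simp [hT]
    have e2 : ∑ p ∈ s', b' p * (N : ℂ) ^ p.1 * ((Real.log N : ℝ) : ℂ) ^ p.2 =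
        ∑ p ∈ T, (if p ∈ s' then b' p else 0) * t p := by
      simp only [ite_mul, zero_mul, ← Finset.sum_filter, ht, mul_assoc]
      refine Finset.sum_congr ?_ fun _ _ => rfl
      ext p; simp [hT]
    have e3 : ∀ α : ℂ, (Q α).eval ((Real.log N : ℝ) : ℂ) * (N : ℂ) ^ α =
        ∑ p ∈ T.filter (fun p => p.1 = α), a p * t p := by
      intro α
      rw [hQ, eval_finsetSum, Finset.sum_mul]
      refine Finset.sum_congr rfl fun p hp => ?_
      rw [← (Finset.mem_filter.mp hp).2]
      simp only [eval_mul, eval_C, eval_pow, eval_X, ht]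
      ring
    have e4 : ∑ p ∈ T, a p * t p =
        (Q 0).eval ((Real.log N : ℝ) : ℂ) +
          ∑ α ∈ U, (Q α).eval ((Real.log N : ℝ) : ℂ) * (N : ℂ) ^ α := by
      have e5 := e3 0
      rw [Complex.cpow_zero, mul_one] at e5
      rw [e5, Finset.sum_congr rfl fun α _ => e3 α,
        ← Finset.sum_fiberwise_of_maps_to (s := T) (t := insert 0 U) (g := Prod.fst),
        Finset.sum_insert (by simp [hU])]
      intro p hp
      by_cases hp0 : p.1 = 0
      · simp [hp0]
      · exact Finset.mem_insert_of_mem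
          (Finset.mem_erase.mpr ⟨hp0, Finset.mem_image_of_mem _ hp⟩)
    rw [eval_add, eval_C, add_assoc, ← e4, e1, e2]
    simp only [ha, sub_mul, Finset.sum_sub_distrib]
    ring

theorem HasFinitePart.finitePart_eq {S : ℕ → ℂ} {c : ℂ} (h : HasFinitePart S c) :
    finitePart S = c := by
  have h' : ∃ c, HasFinitePart S c := ⟨c, h⟩
  rw [finitePart, dif_pos h']
  exact h'.choose_spec.unique h

/-- The truncated nested sum
`f₁ ⊗ ⋯ ⊗ fₖ ↦ ∑_{0 < nₖ < ⋯ < n₁ ≤ N} f₁(n₁) ⋯ fₖ(nₖ)`, extended linearly. -/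
noncomputable def nestedSum (N : ℕ) : Tensors (ℝ → ℂ) →ₗ[ℂ] ℂ :=
  DirectSum.toModule ℂ ℕ ℂ fun k =>
    PiTensorProduct.lift
      (∑ n ∈ (Fintype.piFinset fun _ : Fin k => Finset.Icc 1 N).filter StrictAnti,
        (MultilinearMap.mkPiAlgebra ℂ (Fin k) ℂ).compLinearMap
          fun i => (LinearMap.proj (n i : ℝ) : (ℝ → ℂ) →ₗ[ℂ] ℂ))

/-- The cut-off nested sum (strict inequality version) of the tensor `t` exists and is `c`. -/
def HasCutoffNestedSum (t : Tensors (ℝ → ℂ)) (c : ℂ) : Prop :=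
  HasFinitePart (fun N => nestedSum N t) c

/-- The cut-off nested sum (strict inequality version). -/
noncomputable def cutoffNestedSum (t : Tensors (ℝ → ℂ)) : ℂ :=
  finitePart fun N => nestedSum N t

/-! ### Symbols and the shifted Riesz regularisation -/

/-- Smooth cut-off functions on the line, vanishing to the left of some `ε > 0` and equal to `1`
on `[1, ∞)`. -/
structure IsCutoff (χ : ℝ → ℝ) : Prop where
  smooth : ContDiff ℝ (⊤ : ℕ∞) χ
  vanishes : ∃ ε > 0, ∀ ξ < ε, χ ξ = 0
  eq_one : ∀ ξ ≥ 1, χ ξ = 1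

/-- The symbol `ξ ↦ χ(ξ) (ξ + v)^{-s}`. -/
noncomputable def hurwitzSymbol (χ : ℝ → ℝ) (v : ℝ) (s : ℂ) : ℝ → ℂ :=
  fun ξ => (χ ξ : ℂ) * ((ξ + v : ℝ) : ℂ) ^ (-s)

/-- The Riesz regularisation shifted by `v`, at the parameter `w`: `τ ↦ (ξ ↦ τ(ξ) (ξ + v)^{-w})`. -/
noncomputable def rieszReg (v : ℝ) (w : ℂ) : (ℝ → ℂ) →ₗ[ℂ] (ℝ → ℂ) :=
  LinearMap.mulRight ℂ (fun ξ : ℝ => ((ξ + v : ℝ) : ℂ) ^ (-w))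

/-! ### Birkhoff decomposition and minimal subtraction -/

open Classical in
/-- The projection of `f`, meromorphic at `0`, onto its pole part, an element of `z⁻¹ ℂ[z⁻¹]`;
it is `0` by convention if `f` does not agree with a meromorphic germ near `0`. -/
noncomputable def polePart (f : ℂ → ℂ) : ℂ → ℂ :=
  if h : ∃ p : ℂ[X], p.coeff 0 = 0 ∧ ∃ g : ℂ → ℂ, AnalyticAt ℂ g 0 ∧
      ∀ᶠ z in 𝓝[≠] 0, f z = p.eval z⁻¹ + g z
  then fun z => h.choose.eval z⁻¹ else 0

section Birkhoff

variable {A : Type*}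

/-- The negative part of the Birkhoff decomposition (minimal subtraction scheme) of `Ψ`, evaluated
on the word `w` (that is, on the pure tensor of its letters), for the deconcatenation coproduct:
`Ψ₋(w) = -π (Ψ(w) + ∑ Ψ₋(w') Ψ(w''))`, the sum being over the factorisations `w = w' w''` with
`w'` and `w''` non-empty, and `Ψ₋(1) = 1`. -/
noncomputable def birkhoffNeg (Ψ : List A → ℂ → ℂ) (w : List A) : ℂ → ℂ :=
  if w = [] then 1 else
    -polePart fun z => Ψ w z + ∑ i ∈ (Finset.Ico 1 w.length).attach,
      birkhoffNeg Ψ (w.take i.1) z * Ψ (w.drop i.1) z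
termination_by w.length
decreasing_by
  have := Finset.mem_Ico.mp i.2
  simp only [List.length_take]
  omega

/-- The positive part of the Birkhoff decomposition:
`Ψ₊(w) = (1 - π) (Ψ(w) + ∑ Ψ₋(w') Ψ(w''))`, and `Ψ₊(1) = 1`. -/
noncomputable def birkhoffPos (Ψ : List A → ℂ → ℂ) (w : List A) : ℂ → ℂ :=
  if w = [] then 1 else
    let f : ℂ → ℂ := fun z => Ψ w z + ∑ i ∈ Finset.Ico 1 w.length,
      birkhoffNeg Ψ (w.take i) z * Ψ (w.drop i) z
    f - polePart f

end Birkhoff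

/-- The map `Ψ` attached to a regularisation `R`: it sends the pure tensor `σ₁ ⊗ ⋯ ⊗ σₖ` to the
function whose value at `z` is the cut-off nested sum of `(exp ∘ R̃(z) ∘ log) (σ₁ ⊗ ⋯ ⊗ σₖ)`. -/
noncomputable def regularisedSum (R : ℂ → (ℝ → ℂ) →ₗ[ℂ] (ℝ → ℂ)) (w : List (ℝ → ℂ)) (z : ℂ) : ℂ :=
  cutoffNestedSum (twistedMap (R z) (pureTensor w.get))

/-- `c` is the renormalised nested sum of the pure tensor of the letters of `w` with respect to the
regularisation `R`, namely the value at `0` of the positive Birkhoff part of the map `Ψ`. -/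
def HasRenormalisedNestedSum (R : ℂ → (ℝ → ℂ) →ₗ[ℂ] (ℝ → ℂ)) (w : List (ℝ → ℂ)) (c : ℂ) : Prop :=
  Tendsto (birkhoffPos (regularisedSum R) w) (𝓝[≠] 0) (𝓝 c)

/-! At integers `n ≥ 1` the symbols are powers of `n + v`. Expanding Hoffman's maps therefore turns
the regularised tensor into a rational combination of nested sums of powers `(n + v) ^ (A - q w)`
with `w = γ z` and every `q ≥ 1` (`twistedMap_pureTensor`, `blockProd_rieszReg_hurwitzSymbol`). It
suffices that the constant term of each such sum extends holomorphically to `w = 0`, with a rational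
polynomial in `v` as value there.

The summation starts at the largest index. If `U' n - U' (n + 1) = (n + 1 + v) ^ (A - q w) * U (n +
1)`, summing over the largest index replaces the weight `U` on it by the weight `U'` on the next
one, up to a boundary term `U' N` times a shorter nested sum (`weightedNestedSum_cons`). For small
`w ≠ 0` the boundary term expands in powers with exponents `m - q w`, `q ≥ 1`, none of them zero, so
it has no constant term. Once all indices are used up, the constant term is the last weight at `n =
0` (`exists_weightedNestedSum_expansion`).

The crux is that `U'` can be chosen without pole at `w = 0`. The coefficients of its expansion solve
a triangular system with minus the exponents on the diagonal. The only diagonal entry vanishing at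
`w = 0` is `p w`, and the quantity to be divided by it also vanishes there: at `w = 0` everything is
polynomial, and differences of polynomials have no negative powers (`antidiffCoeff_aux`). The
coefficients remain rational functions of `w` over `ℚ`, and at `w = 0` the weight is exactly a
polynomial in `n + v` (`IsTail.exists_succ`). Each step raises its degree by `A + 1` and keeps the
leading coefficient nonzero. Contracted tensors give smaller degree, so the uncontracted one fixes
the degree of the total.

As `Ψ` is holomorphic on all words in these symbols, there is nothing to subtract: `Ψ₋` vanishes on
non-empty words and `Ψ₊ = Ψ` (`birkhoffPos_eq`). -/

/-! ### Rational functions with rational coefficients on a closed disc -/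

/-- On the closed disc of radius `δ`, the function `f` is a quotient of polynomials with rational
coefficients whose denominator does not vanish. -/
def IsRatOn (δ : ℝ) (f : ℂ → ℂ) : Prop :=
  ∃ p q : ℚ[X], ∀ w : ℂ, ‖w‖ ≤ δ → aeval w q ≠ 0 ∧ f w = aeval w p / aeval w q

namespace IsRatOn

variable {δ : ℝ} {f g : ℂ → ℂ}

theorem congr (hf : IsRatOn δ f) (h : ∀ w : ℂ, ‖w‖ ≤ δ → g w = f w) : IsRatOn δ g := by
  obtain ⟨p, q, H⟩ := hf
  exact ⟨p, q, fun w hw => ⟨(H w hw).1, (h w hw).trans (H w hw).2⟩⟩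

theorem polynomial (p : ℚ[X]) : IsRatOn δ fun w => aeval w p :=
  ⟨p, 1, fun w _ => by simp⟩

theorem ratCast (r : ℚ) : IsRatOn δ fun _ => (r : ℂ) :=
  (polynomial (C r)).congr fun w _ => by simp

theorem add (hf : IsRatOn δ f) (hg : IsRatOn δ g) : IsRatOn δ fun w => f w + g w := by
  obtain ⟨p, q, H⟩ := hf
  obtain ⟨p', q', H'⟩ := hg
  refine ⟨p * q' + q * p', q * q', fun w hw => ?_⟩
  obtain ⟨h1, h2⟩ := H w hw
  obtain ⟨h3, h4⟩ := H' w hw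
  refine ⟨by simp [h1, h3], ?_⟩
  simp only [h2, h4, map_add, map_mul]
  rw [div_add_div _ _ h1 h3]

theorem mul (hf : IsRatOn δ f) (hg : IsRatOn δ g) : IsRatOn δ fun w => f w * g w := by
  obtain ⟨p, q, H⟩ := hf
  obtain ⟨p', q', H'⟩ := hg
  refine ⟨p * p', q * q', fun w hw => ?_⟩
  obtain ⟨h1, h2⟩ := H w hw
  obtain ⟨h3, h4⟩ := H' w hw
  refine ⟨by simp [h1, h3], ?_⟩
  simp only [h2, h4, map_mul]
  rw [div_mul_div_comm]

theorem neg (hf : IsRatOn δ f) : IsRatOn δ fun w => -f w :=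
  ((ratCast (-1)).mul hf).congr fun w _ => by simp

theorem sub (hf : IsRatOn δ f) (hg : IsRatOn δ g) : IsRatOn δ fun w => f w - g w :=
  (hf.add hg.neg).congr fun w _ => by ring

theorem sum {ι : Type*} {f : ι → ℂ → ℂ} (s : Finset ι) (hf : ∀ i ∈ s, IsRatOn δ (f i)) :
    IsRatOn δ fun w => ∑ i ∈ s, f i w := by
  classical
  induction s using Finset.induction_on with
  | empty => exact (ratCast 0).congr fun w _ => by simp
  | insert a s ha ih =>
    refine ((hf a (by simp)).add (ih fun i hi => hf i (by simp [hi]))).congr fun w _ => ?_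
    rw [Finset.sum_insert ha]

theorem div_polynomial (hf : IsRatOn δ f) (r : ℚ[X]) (hr : ∀ w : ℂ, ‖w‖ ≤ δ → aeval w r ≠ 0) :
    IsRatOn δ fun w => f w / aeval w r := by
  obtain ⟨p, q, H⟩ := hf
  refine ⟨p, q * r, fun w hw => ?_⟩
  obtain ⟨h1, h2⟩ := H w hw
  refine ⟨by simp [h1, hr w hw], ?_⟩
  simp only [h2, map_mul]
  rw [div_div]

theorem differentiableAt (hf : IsRatOn δ f) {w : ℂ} (hw : ‖w‖ < δ) : DifferentiableAt ℂ f w := by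
  obtain ⟨p, q, H⟩ := hf
  have h : DifferentiableAt ℂ (fun w => aeval w p / aeval w q) w :=
    (p.differentiable_aeval _).fun_div (q.differentiable_aeval _) (H w hw.le).1
  refine h.congr_of_eventuallyEq ?_
  filter_upwards [(isOpen_lt continuous_norm continuous_const).mem_nhds hw] with z hz
  exact (H z (le_of_lt hz)).2

theorem differentiableOn (hf : IsRatOn δ f) : DifferentiableOn ℂ f (Metric.ball 0 δ) :=
  fun _ hw => (hf.differentiableAt (by simpa using hw)).differentiableWithinAt

/-- Compactness gives the bound; this is why `IsRatOn` refers to the closed disc, although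
holomorphy is used only on the open one. -/
theorem bounded (hf : IsRatOn δ f) : ∃ K, ∀ w : ℂ, ‖w‖ ≤ δ → ‖f w‖ ≤ K := by
  obtain ⟨p, q, H⟩ := hf
  have hc : ContinuousOn (fun w => aeval w p / aeval w q) (Metric.closedBall (0 : ℂ) δ) :=
    (p.differentiable_aeval.continuous.continuousOn).div
      (q.differentiable_aeval.continuous.continuousOn) fun w hw => (H w (by simpa using hw)).1
  obtain ⟨K, hK⟩ := (isCompact_closedBall (0 : ℂ) δ).exists_bound_of_continuousOn hc
  exact ⟨K, fun w hw => by rw [(H w hw).2]; exact hK w (by simpa using hw)⟩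

/-- The source of the rationality of the final polynomial. -/
theorem exists_rat (hf : IsRatOn δ f) (hδ : 0 ≤ δ) : ∃ r : ℚ, f 0 = r := by
  obtain ⟨p, q, H⟩ := hf
  refine ⟨p.coeff 0 / q.coeff 0, ?_⟩
  have e : ∀ r : ℚ[X], aeval (0 : ℂ) r = (r.coeff 0 : ℂ) := fun r => by
    rw [← coeff_zero_eq_aeval_zero']; simp
  rw [(H 0 (by simpa using hδ)).2, e, e]
  push_cast; rfl

/-- A rational function which vanishes at `0` is divisible by the coordinate. -/
theorem dslope (hf : IsRatOn δ f) (hδ : 0 < δ) (h0 : f 0 = 0) : IsRatOn δ (dslope f 0) := by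
  have hd := hf.differentiableAt (w := 0) (by simpa using hδ)
  obtain ⟨p, q, H⟩ := hf
  have hq := (H 0 (by simpa using hδ.le)).1
  have hp : p.coeff 0 = 0 := by
    have h := (H 0 (by simpa using hδ.le)).2
    rw [h0, eq_comm, div_eq_zero_iff, or_iff_left hq, ← coeff_zero_eq_aeval_zero'] at h
    simpa using h
  obtain ⟨p', rfl⟩ := X_dvd_iff.mpr hp
  have key : ∀ w : ℂ, ‖w‖ ≤ δ → w ≠ 0 → _root_.dslope f 0 w = aeval w p' / aeval w q := by
    intro w hw hw0
    rw [dslope_of_ne _ hw0, slope_def_field, h0, (H w hw).2]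
    simp only [map_mul, aeval_X, sub_zero]
    field_simp
  refine ⟨p', q, fun w hw => ⟨(H w hw).1, ?_⟩⟩
  rcases eq_or_ne w 0 with rfl | hw0
  · have h1 : ContinuousAt (_root_.dslope f 0) 0 := continuousAt_dslope_same.mpr hd
    have h2 : ContinuousAt (fun w => aeval w p' / aeval w q) (0 : ℂ) :=
      (p'.differentiable_aeval _).continuousAt.div (q.differentiable_aeval _).continuousAt hq
    refine tendsto_nhds_unique (h1.tendsto.mono_left nhdsWithin_le_nhds)
      ((h2.tendsto.mono_left (nhdsWithin_le_nhds (s := {0}ᶜ))).congr' ?_)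
    filter_upwards [self_mem_nhdsWithin, mem_nhdsWithin_of_mem_nhds
      (Metric.closedBall_mem_nhds (0 : ℂ) hδ)] with z hz hz'
    exact (key z (by simpa using hz') hz).symm
  · exact key w hw hw0

end IsRatOn

/-! ### The binomial expansion, uniformly in the exponent -/

theorem ringChoose_succ (β : ℂ) (r : ℕ) :
    Ring.choose β (r + 1) = Ring.choose β r * (β - r) / (r + 1) := by
  rw [Ring.choose_eq_smul, Ring.choose_eq_smul, descPochhammer_succ_right]
  simp only [smul_eq_mul, Nat.factorial_succ, Polynomial.smeval_mul, Polynomial.smeval_sub,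
    Polynomial.smeval_X, Polynomial.smeval_natCast]
  push_cast
  have h1 : (r.factorial : ℂ) ≠ 0 := by exact_mod_cast r.factorial_ne_zero
  have h2 : (r + 1 : ℂ) ≠ 0 := by exact_mod_cast r.succ_ne_zero
  field_simp
  simp

/-- Factor by factor, `|β - j| ≤ B + j = |-B - j|`. The majorant does not depend on `β`, which makes
the binomial remainders uniform in `w`. -/
theorem norm_ringChoose_le {β : ℂ} {B : ℝ} (hβ : ‖β‖ ≤ B) (r : ℕ) :
    ‖Ring.choose β r‖ ≤ ‖Ring.choose (-(B : ℂ)) r‖ := by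
  induction r with
  | zero => simp
  | succ r ih =>
    rw [ringChoose_succ, ringChoose_succ, norm_div, norm_div, norm_mul, norm_mul]
    have h1 : ‖-(B : ℂ) - r‖ = B + r := by
      have : -(B : ℂ) - r = -((B + r : ℝ) : ℂ) := by push_cast; ring
      rw [this, norm_neg, Complex.norm_real, Real.norm_of_nonneg]
      exact add_nonneg ((norm_nonneg β).trans hβ) r.cast_nonneg
    have h2 : ‖β - r‖ ≤ B + r := (norm_sub_le _ _).trans (by simpa using hβ)
    rw [h1]
    gcongr

theorem isRatOn_ringChoose {δ : ℝ} {f : ℂ → ℂ} (hf : IsRatOn δ f) (r : ℕ) :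
    IsRatOn δ fun w => Ring.choose (f w) r := by
  induction r with
  | zero => exact (IsRatOn.ratCast 1).congr fun w _ => by simp
  | succ r ih =>
    refine ((ih.mul (hf.sub (.ratCast r))).mul (.ratCast (1 / (r + 1)))).congr fun w _ => ?_
    rw [ringChoose_succ]
    push_cast
    ring

theorem hasSum_one_add_cpow (β : ℂ) {t : ℂ} (ht : ‖t‖ < 1) :
    HasSum (fun r : ℕ => Ring.choose β r * t ^ r) ((1 + t) ^ β) := by
  have h := (Complex.one_add_cpow_hasFPowerSeriesOnBall_zero (a := β)).hasSum (y := t)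
    (by simpa [enorm_eq_nnnorm, ← NNReal.coe_lt_coe] using ht)
  simpa [binomialSeries, mul_comm] using h

/-- The tail of the binomial series is dominated by that of the series for the exponent `-B` at `1 /
2`, which converges absolutely; `‖t‖ ^ R` is factored out. -/
theorem exists_norm_one_add_cpow_sub_le (B : ℝ) (R : ℕ) :
    ∃ K, 0 ≤ K ∧ ∀ β : ℂ, ‖β‖ ≤ B → ∀ t : ℂ, ‖t‖ ≤ 1 / 2 →
      ‖(1 + t) ^ β - ∑ r ∈ Finset.range R, Ring.choose β r * t ^ r‖ ≤ K * ‖t‖ ^ R := by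
  have hs : Summable fun r : ℕ => ‖Ring.choose (-(B : ℂ)) (r + R)‖ * (1 / 2 : ℝ) ^ (r + R) := by
    have h : Summable fun r : ℕ => ‖Ring.choose (-(B : ℂ)) r‖ * (1 / 2 : ℝ) ^ r := by
      simpa using (hasSum_one_add_cpow (-(B : ℂ)) (t := 1 / 2) (by norm_num)).summable.norm
    exact (summable_nat_add_iff R).mpr h
  refine ⟨2 ^ R * ∑' r : ℕ, ‖Ring.choose (-(B : ℂ)) (r + R)‖ * (1 / 2 : ℝ) ^ (r + R),
    by positivity, fun β hβ t ht => ?_⟩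
  have h := hasSum_one_add_cpow β (t := t) (by linarith)
  have h1 := (hasSum_nat_add_iff' R).mpr h
  rw [← h1.tsum_eq]
  have h2 : ∀ r : ℕ, ‖Ring.choose β (r + R) * t ^ (r + R)‖ ≤
      2 ^ R * ‖t‖ ^ R * (‖Ring.choose (-(B : ℂ)) (r + R)‖ * (1 / 2 : ℝ) ^ (r + R)) := by
    intro r
    rw [norm_mul, norm_pow]
    have e : (2 : ℝ) ^ R * ‖t‖ ^ R * (‖Ring.choose (-(B : ℂ)) (r + R)‖ * (1 / 2 : ℝ) ^ (r + R))
        = ‖Ring.choose (-(B : ℂ)) (r + R)‖ * ((1 / 2) ^ r * ‖t‖ ^ R) := by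
      have : (2 : ℝ) ^ R * (1 / 2) ^ (r + R) = (1 / 2) ^ r := by
        rw [pow_add, mul_left_comm, ← mul_pow]; norm_num
      linear_combination ‖t‖ ^ R * ‖Ring.choose (-(B : ℂ)) (r + R)‖ * this
    rw [e, pow_add]
    gcongr
    exact norm_ringChoose_le hβ _
  refine (tsum_of_norm_bounded (hs.hasSum.mul_left (2 ^ R * ‖t‖ ^ R)) h2).trans_eq ?_
  ring

/-! ### A triangular system for the coefficients of antidifferences -/

/-- The coefficient of `x ^ (M - 1 - i - p w)` in the expansion of `(x - 1) ^ (M - l - p w)`. -/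
noncomputable def shiftCoeff (M p i l : ℕ) (w : ℂ) : ℂ :=
  (-1) ^ (i - l + 1) * Ring.choose ((M : ℂ) - l - p * w) (i - l + 1)

theorem isRatOn_shiftCoeff (δ : ℝ) (M p i l : ℕ) : IsRatOn δ (shiftCoeff M p i l) := by
  have h : IsRatOn δ fun w => (M : ℂ) - l - p * w :=
    (IsRatOn.polynomial (C (M : ℚ) - C (l : ℚ) - C (p : ℚ) * X)).congr fun w _ => by simp
  exact ((IsRatOn.ratCast ((-1) ^ (i - l + 1))).mul (isRatOn_ringChoose h (i - l + 1))).congr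
    fun w _ => by rw [shiftCoeff]; push_cast; rfl

theorem shiftCoeff_self (M p i : ℕ) (w : ℂ) : shiftCoeff M p i i w = -((M : ℂ) - i - p * w) := by
  simp [shiftCoeff]

/-- At `w = 0` the power `(x - 1) ^ (M - l)` is a polynomial, and `i ≥ M` asks for a negative power
of `x`. -/
theorem shiftCoeff_zero {M p i l : ℕ} (hl : l ≤ M) (hli : l ≤ i) (hi : M ≤ i) :
    shiftCoeff M p i l 0 = 0 := by
  have : (M : ℂ) - l - p * 0 = ((M - l : ℕ) : ℂ) := by push_cast [hl]; ring
  rw [shiftCoeff, this, Ring.choose_natCast, Nat.choose_eq_zero_of_lt (by omega)]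
  simp

/-- Division by `-(M - i - p w)`, the singularity at `0` for `i = M` being removed. -/
noncomputable def divExponent (M p i : ℕ) (f : ℂ → ℂ) (w : ℂ) : ℂ :=
  if i = M then dslope f 0 w / p else f w / -((M : ℂ) - i - p * w)

/-- `M - i` is a nonzero integer, whereas `p w` has norm at most `1 / 2`. -/
theorem exponent_ne_zero {M p i : ℕ} {δ : ℝ} (hpδ : p * δ ≤ 1 / 2) (hi : i ≠ M) {w : ℂ}
    (hw : ‖w‖ ≤ δ) : -((M : ℂ) - i - p * w) ≠ 0 := by
  intro h
  have h1 : (((M : ℤ) - i : ℤ) : ℂ) = p * w := by push_cast; linear_combination -h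
  have h2 : (1 : ℝ) ≤ ‖(((M : ℤ) - i : ℤ) : ℂ)‖ := by
    rw [Complex.norm_intCast]
    have h0 : (M : ℤ) - i ≠ 0 := by omega
    exact_mod_cast Int.one_le_abs h0
  rw [h1, norm_mul, Complex.norm_natCast] at h2
  have h3 : (p : ℝ) * ‖w‖ ≤ p * δ := by gcongr
  linarith

theorem isRatOn_divExponent {M p i : ℕ} {δ : ℝ} (hδ : 0 < δ) (hpδ : p * δ ≤ 1 / 2)
    {f : ℂ → ℂ} (hf : IsRatOn δ f) (h0 : i = M → f 0 = 0) : IsRatOn δ (divExponent M p i f) := by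
  by_cases hi : i = M
  · refine ((hf.dslope hδ (h0 hi)).mul (.ratCast (1 / p))).congr fun w _ => ?_
    rw [divExponent, if_pos hi]
    push_cast
    ring
  · refine (hf.div_polynomial (-(C (M : ℚ) - C (i : ℚ) - C (p : ℚ) * X)) fun w hw => ?_).congr
      fun w _ => ?_
    · simpa using exponent_ne_zero hpδ hi hw
    · rw [divExponent, if_neg hi]; simp

theorem divExponent_mul {M p i : ℕ} {δ : ℝ} (hp : 1 ≤ p) (hpδ : p * δ ≤ 1 / 2)
    {f : ℂ → ℂ} (h0 : i = M → f 0 = 0) {w : ℂ} (hw : ‖w‖ ≤ δ) :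
    divExponent M p i f w * -((M : ℂ) - i - p * w) = f w := by
  by_cases hi : i = M
  · have hp0 : (p : ℂ) ≠ 0 := by exact_mod_cast (by omega : p ≠ 0)
    have h1 := sub_smul_dslope f 0 w
    rw [h0 hi, sub_zero, sub_zero, smul_eq_mul] at h1
    rw [divExponent, if_pos hi, hi, ← h1]
    field_simp
    ring
  · rw [divExponent, if_neg hi, div_mul_cancel₀ _ (exponent_ne_zero hpδ hi hw)]

/-- The solution of the triangular system `∑_{l ≤ i} c l * shiftCoeff M p i l = d i`. -/
noncomputable def antidiffCoeff (M p : ℕ) (d : ℕ → ℂ → ℂ) : ℕ → ℂ → ℂ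
  | i => divExponent M p i fun w =>
      d i w - ∑ l : Fin i, antidiffCoeff M p d l.1 w * shiftCoeff M p i l w
decreasing_by exact l.2

/-- `c` is a family of coefficients `c i`, rational over `ℚ` on the disc of radius `δ`, and vanishing
at `0` when `i > M`. -/
structure IsCoeffFamily (δ : ℝ) (M : ℕ) (c : ℕ → ℂ → ℂ) : Prop where
  rat : ∀ i, IsRatOn δ (c i)
  vanish : ∀ i, M < i → c i 0 = 0

section antidiffCoeff

variable {M p : ℕ} {δ : ℝ} {d : ℕ → ℂ → ℂ}

theorem antidiffCoeff_eq (i : ℕ) : antidiffCoeff M p d i = divExponent M p i fun w =>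
    d i w - ∑ l ∈ Finset.range i, antidiffCoeff M p d l w * shiftCoeff M p i l w := by
  rw [antidiffCoeff]
  congr 1
  funext w
  rw [Finset.sum_range]

/-- The three claims need each other. In the numerator of the `i`-th coefficient with `i ≥ M + 1`,
at `w = 0`, `d i` vanishes by assumption, the terms with `l ≤ M + 1` vanish by `shiftCoeff_zero`,
and those with `l > M + 1` by induction. For `i = M + 1` this removes the pole; for larger `i` it
makes the coefficient itself vanish at `0`. -/
theorem antidiffCoeff_aux (hδ : 0 < δ) (hpδ : p * δ ≤ 1 / 2)
    (hd : IsCoeffFamily δ M d) (i : ℕ) :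
    IsRatOn δ (antidiffCoeff (M + 1) p d i) ∧
      (M + 1 < i → antidiffCoeff (M + 1) p d i 0 = 0) ∧
      (M + 1 ≤ i → d i 0 - ∑ l ∈ Finset.range i,
        antidiffCoeff (M + 1) p d l 0 * shiftCoeff (M + 1) p i l 0 = 0) := by
  induction i using Nat.strong_induction_on with
  | _ i ih =>
    have h0 : M + 1 ≤ i → d i 0 - ∑ l ∈ Finset.range i,
        antidiffCoeff (M + 1) p d l 0 * shiftCoeff (M + 1) p i l 0 = 0 := by
      intro hi
      rw [hd.vanish i (by omega), zero_sub, neg_eq_zero]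
      refine Finset.sum_eq_zero fun l hl => ?_
      have hl' := Finset.mem_range.mp hl
      rcases le_or_gt l (M + 1) with h | h
      · rw [shiftCoeff_zero h hl'.le hi, mul_zero]
      · rw [(ih l hl').2.1 h, zero_mul]
    refine ⟨?_, fun hi => ?_, h0⟩
    · rw [antidiffCoeff_eq]
      refine isRatOn_divExponent hδ hpδ ((hd.rat i).sub (IsRatOn.sum _ fun l hl => ?_))
        fun hi => h0 hi.ge
      exact (ih l (Finset.mem_range.mp hl)).1.mul (isRatOn_shiftCoeff _ _ _ _ _)
    · rw [antidiffCoeff_eq, divExponent, if_neg (by omega), h0 hi.le, zero_div]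

theorem isCoeffFamily_antidiffCoeff (hδ : 0 < δ) (hpδ : p * δ ≤ 1 / 2)
    (hd : IsCoeffFamily δ M d) : IsCoeffFamily δ (M + 1) (antidiffCoeff (M + 1) p d) :=
  ⟨fun i => (antidiffCoeff_aux hδ hpδ hd i).1, fun i => (antidiffCoeff_aux hδ hpδ hd i).2.1⟩

theorem sum_antidiffCoeff_mul_shiftCoeff (hδ : 0 < δ) (hp : 1 ≤ p) (hpδ : p * δ ≤ 1 / 2)
    (hd : IsCoeffFamily δ M d) (i : ℕ) {w : ℂ} (hw : ‖w‖ ≤ δ) :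
    ∑ l ∈ Finset.range (i + 1), antidiffCoeff (M + 1) p d l w * shiftCoeff (M + 1) p i l w =
      d i w := by
  rw [Finset.sum_range_succ, shiftCoeff_self]
  have h := divExponent_mul hp hpδ (f := fun w => d i w - ∑ l ∈ Finset.range i,
    antidiffCoeff (M + 1) p d l w * shiftCoeff (M + 1) p i l w)
    (fun hi => (antidiffCoeff_aux hδ hpδ hd i).2.2 hi.ge) hw
  rw [← antidiffCoeff_eq] at h
  rw [h]
  ring

/-- Keeps the leading coefficient nonzero along the induction, so that degrees are exact. -/
theorem antidiffCoeff_zero_zero : antidiffCoeff (M + 1) p d 0 0 = -d 0 0 / (M + 1) := by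
  rw [antidiffCoeff_eq, divExponent, if_neg (by omega)]
  simp
  rw [show (-1 + -(M : ℂ)) = -((M : ℂ) + 1) by ring, div_neg, neg_div]

end antidiffCoeff

/-! ### Asymptotic expansions in powers of `n + v` -/

/-- The truncation to `L` terms of the expansion `∑ᵢ cᵢ(w) x ^ (M - i - p w)`. -/
noncomputable def expansion (c : ℕ → ℂ → ℂ) (M p L : ℕ) (x : ℝ) (w : ℂ) : ℂ :=
  ∑ i ∈ Finset.range L, c i w * (x : ℂ) ^ ((M : ℂ) - i - p * w)

/-- `U n w` has the asymptotic expansion `∑ᵢ cᵢ(w) (n + v) ^ (M - i - p w)` as `n → ∞`, uniformly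
for `w` in the disc of radius `δ`. -/
def HasExpansion (δ v : ℝ) (c : ℕ → ℂ → ℂ) (M p : ℕ) (U : ℕ → ℂ → ℂ) : Prop :=
  ∀ L : ℕ, ∃ K, ∀ w : ℂ, ‖w‖ < δ → ∀ n : ℕ, 1 ≤ n →
    ‖U n w - expansion c M p L (n + v) w‖ ≤ K * (n + v) ^ ((M : ℤ) + 1 - L)

/-- The real part of `-p w` is at most `1 / 2`; rounding it up to `1` gives an integer exponent
independent of `w`. -/
theorem norm_cpow_exponent_le {δ : ℝ} {M p i : ℕ} (hpδ : p * δ ≤ 1 / 2) {x : ℝ} (hx : 1 ≤ x)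
    {w : ℂ} (hw : ‖w‖ < δ) :
    ‖(x : ℂ) ^ ((M : ℂ) - i - p * w)‖ ≤ x ^ ((M : ℤ) + 1 - i) := by
  rw [Complex.norm_cpow_eq_rpow_re_of_pos (by linarith), ← Real.rpow_intCast]
  refine Real.rpow_le_rpow_of_exponent_le hx ?_
  have h1 : |w.re| ≤ δ := (Complex.abs_re_le_norm w).trans hw.le
  have h2 : (p : ℝ) * -w.re ≤ p * δ := by gcongr; exact (neg_le_abs _).trans h1
  simp
  linarith

theorem exists_norm_expansion_sub_le {δ : ℝ} {M p : ℕ} (hpδ : p * δ ≤ 1 / 2) {c : ℕ → ℂ → ℂ}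
    (hc : ∀ i, IsRatOn δ (c i)) {L L' : ℕ} (hL : L ≤ L') :
    ∃ K, 0 ≤ K ∧ ∀ w : ℂ, ‖w‖ < δ → ∀ x : ℝ, 1 ≤ x →
      ‖expansion c M p L' x w - expansion c M p L x w‖ ≤ K * x ^ ((M : ℤ) + 1 - L) := by
  choose B hB using fun i => (hc i).bounded
  refine ⟨∑ i ∈ Finset.Ico L L', |B i|, by positivity, fun w hw x hx => ?_⟩
  rw [expansion, expansion, ← Finset.sum_Ico_eq_sub _ hL, Finset.sum_mul]
  refine norm_sum_le_of_le _ fun i hi => ?_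
  rw [norm_mul]
  have h1 : x ^ ((M : ℤ) + 1 - i) ≤ x ^ ((M : ℤ) + 1 - L) :=
    zpow_le_zpow_right₀ hx (by have := (Finset.mem_Ico.mp hi).1; omega)
  exact mul_le_mul ((hB i w hw.le).trans (le_abs_self _))
    ((norm_cpow_exponent_le hpδ hx hw).trans h1) (norm_nonneg _) (abs_nonneg _)

theorem differentiableOn_expansion {δ : ℝ} {M p L : ℕ} {c : ℕ → ℂ → ℂ}
    (hc : ∀ i, IsRatOn δ (c i)) {x : ℝ} (hx : 0 < x) :
    DifferentiableOn ℂ (expansion c M p L x) (Metric.ball 0 δ) := by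
  refine DifferentiableOn.fun_sum fun i _ => (hc i).differentiableOn.mul ?_
  have hx' : (x : ℂ) ≠ 0 := by exact_mod_cast hx.ne'
  refine Differentiable.differentiableOn ?_
  intro w
  exact DifferentiableAt.const_cpow (by fun_prop) (Or.inl hx')

/-! ### Differences of asymptotic expansions -/

theorem ofReal_sub_one_cpow (x : ℝ) (hx : 2 ≤ x) (β : ℂ) :
    ((x - 1 : ℝ) : ℂ) ^ β = (x : ℂ) ^ β * (1 + -(x : ℂ)⁻¹) ^ β := by
  have hx0 : (0 : ℝ) < x := by linarith
  have h1 : x - 1 = x * (1 + -x⁻¹) := by field_simp; ring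
  have h2 : (0 : ℝ) ≤ 1 + -x⁻¹ := by
    have := inv_le_one_of_one_le₀ (by linarith : (1 : ℝ) ≤ x)
    linarith
  rw [h1, Complex.ofReal_mul, Complex.mul_cpow_ofReal_nonneg hx0.le h2]
  push_cast
  rfl

/-- Write `(x - 1) ^ β = x ^ β * (1 - 1 / x) ^ β` and expand to order `L - i + 1`: the term `r = 0`
cancels `x ^ β`, the others are the shift coefficients. The remainder has exponent `(M + 2 - i) - (L
- i + 1) = M + 1 - L`. -/
theorem exists_norm_cpow_shift_sub_le {δ : ℝ} {M p i L : ℕ} (hpδ : p * δ ≤ 1 / 2) (hi : i < L) :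
    ∃ K, 0 ≤ K ∧ ∀ w : ℂ, ‖w‖ < δ → ∀ x : ℝ, 2 ≤ x →
      ‖((x - 1 : ℝ) : ℂ) ^ (((M + 1 : ℕ) : ℂ) - i - p * w)
          - (x : ℂ) ^ (((M + 1 : ℕ) : ℂ) - i - p * w)
        - ∑ j ∈ Finset.Ico i L, shiftCoeff (M + 1) p j i w * (x : ℂ) ^ ((M : ℂ) - j - p * w)‖
        ≤ K * x ^ ((M : ℤ) + 1 - L) := by
  obtain ⟨K, hK, H⟩ := exists_norm_one_add_cpow_sub_le ((M + 1 : ℕ) + i + p * δ) (L - i + 1)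
  refine ⟨K, hK, fun w hw x hx => ?_⟩
  have hx0 : 0 < x := by linarith
  have hxc : (x : ℂ) ≠ 0 := by exact_mod_cast hx0.ne'
  set β : ℂ := ((M + 1 : ℕ) : ℂ) - i - p * w with hβ
  have hβB : ‖β‖ ≤ (M + 1 : ℕ) + i + p * δ := by
    refine (norm_sub_le _ _).trans (add_le_add ((norm_sub_le _ _).trans ?_) ?_)
    · rw [Complex.norm_natCast, Complex.norm_natCast]
    · rw [norm_mul, Complex.norm_natCast]; gcongr
  have ht : ‖-(x : ℂ)⁻¹‖ ≤ 1 / 2 := by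
    rw [norm_neg, norm_inv, Complex.norm_real, Real.norm_of_nonneg hx0.le, one_div]
    exact inv_anti₀ two_pos hx
  have h := H β hβB _ ht
  have e : ((x - 1 : ℝ) : ℂ) ^ β - (x : ℂ) ^ β
        - ∑ j ∈ Finset.Ico i L, shiftCoeff (M + 1) p j i w * (x : ℂ) ^ ((M : ℂ) - j - p * w) =
      (x : ℂ) ^ β * ((1 + -(x : ℂ)⁻¹) ^ β
        - ∑ r ∈ Finset.range (L - i + 1), Ring.choose β r * (-(x : ℂ)⁻¹) ^ r) := by
    rw [ofReal_sub_one_cpow x hx, Finset.sum_range_succ', Finset.sum_Ico_eq_sum_range,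
      mul_sub, mul_add, Finset.mul_sum]
    have : ∀ r ∈ Finset.range (L - i), shiftCoeff (M + 1) p (i + r) i w *
        (x : ℂ) ^ ((M : ℂ) - ((i + r : ℕ) : ℂ) - p * w) =
        (x : ℂ) ^ β * (Ring.choose β (r + 1) * (-(x : ℂ)⁻¹) ^ (r + 1)) := by
      intro r _
      have e1 : (M : ℂ) - ((i + r : ℕ) : ℂ) - p * w = β - ((r + 1 : ℕ) : ℂ) := by
        rw [hβ]; push_cast; ring
      rw [e1, Complex.cpow_sub _ _ hxc, Complex.cpow_natCast, shiftCoeff, ← hβ,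
        Nat.add_sub_cancel_left, neg_pow (x : ℂ)⁻¹, inv_pow]
      ring
    rw [Finset.sum_congr rfl this]
    simp
    ring
  rw [e, norm_mul]
  have h1 := norm_cpow_exponent_le (M := M + 1) (i := i) hpδ (by linarith : 1 ≤ x) hw
  rw [← hβ] at h1
  refine (mul_le_mul h1 h (norm_nonneg _) (by positivity)).trans_eq ?_
  rw [norm_neg, norm_inv, Complex.norm_real, Real.norm_of_nonneg hx0.le, mul_left_comm,
    ← zpow_natCast, inv_zpow', ← zpow_add₀ hx0.ne']
  congr 2
  push_cast [hi.le]
  ring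

/-- By the triangular system, the difference of the truncated expansion with coefficients `c`
reproduces the one with coefficients `d`, up to the errors of the `L` binomial expansions. -/
theorem exists_norm_remainder_le {δ v : ℝ} {M p : ℕ} {g c d : ℕ → ℂ → ℂ} (hv : 0 ≤ v)
    (hpδ : p * δ ≤ 1 / 2) (hc : ∀ i, IsRatOn δ (c i))
    (hsys : ∀ i w, ‖w‖ ≤ δ →
      ∑ l ∈ Finset.range (i + 1), c l w * shiftCoeff (M + 1) p i l w = d i w)
    (hg : HasExpansion δ v d M p g) (L : ℕ) :
    ∃ K, 0 ≤ K ∧ ∀ w : ℂ, ‖w‖ < δ → ∀ n : ℕ, 1 ≤ n →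
      ‖g (n + 1) w - (expansion c (M + 1) p L (n + v) w -
        expansion c (M + 1) p L ((n + 1 : ℕ) + v) w)‖
        ≤ K * ((n + 1 : ℕ) + v) ^ ((M : ℤ) + 1 - L) := by
  obtain ⟨K₁, hK₁⟩ := hg L
  choose B hB using fun i => (hc i).bounded
  choose! K hK0 hK using fun (i : ℕ) (hi : i < L) =>
    exists_norm_cpow_shift_sub_le (δ := δ) (M := M) (p := p) hpδ hi
  have hK0' : ∀ i ∈ Finset.range L, 0 ≤ |B i| * K i := fun i hi =>
    mul_nonneg (abs_nonneg _) (hK0 i (Finset.mem_range.mp hi))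
  refine ⟨|K₁| + ∑ i ∈ Finset.range L, |B i| * K i,
    add_nonneg (abs_nonneg _) (Finset.sum_nonneg hK0'), fun w hw n hn => ?_⟩
  set x : ℝ := (n + 1 : ℕ) + v with hx
  have hx2 : 2 ≤ x := by
    have : (1 : ℝ) ≤ n := by exact_mod_cast hn
    rw [hx]; push_cast; linarith
  have hxn : (n : ℝ) + v = x - 1 := by rw [hx]; push_cast; ring
  have e : expansion d M p L x w = ∑ i ∈ Finset.range L, c i w *
      ∑ j ∈ Finset.Ico i L, shiftCoeff (M + 1) p j i w * (x : ℂ) ^ ((M : ℂ) - j - p * w) := by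
    simp only [expansion, Finset.mul_sum, Finset.range_eq_Ico]
    rw [Finset.sum_Ico_Ico_comm]
    refine Finset.sum_congr rfl fun j _ => ?_
    rw [← hsys j w hw.le, Finset.sum_mul, Finset.range_eq_Ico]
    exact Finset.sum_congr rfl fun i _ => by ring
  have e' : g (n + 1) w - (expansion c (M + 1) p L (n + v) w - expansion c (M + 1) p L x w) =
      (g (n + 1) w - expansion d M p L x w) -
      ∑ i ∈ Finset.range L, c i w * (((x - 1 : ℝ) : ℂ) ^ (((M + 1 : ℕ) : ℂ) - i - p * w)
          - (x : ℂ) ^ (((M + 1 : ℕ) : ℂ) - i - p * w)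
        - ∑ j ∈ Finset.Ico i L,
            shiftCoeff (M + 1) p j i w * (x : ℂ) ^ ((M : ℂ) - j - p * w)) := by
    rw [e, hxn]
    simp only [expansion, mul_sub, Finset.sum_sub_distrib]
    ring
  rw [e', add_mul, Finset.sum_mul]
  refine (norm_sub_le _ _).trans (add_le_add ?_ (norm_sum_le_of_le _ fun i hi => ?_))
  · refine (hK₁ w hw (n + 1) (by omega)).trans ?_
    gcongr
    exact le_abs_self _
  · rw [norm_mul, mul_assoc]
    exact mul_le_mul ((hB i w hw.le).trans (le_abs_self _))
      (hK i (Finset.mem_range.mp hi) w hw x hx2) (norm_nonneg _) (abs_nonneg _)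

/-! ### Holomorphic antidifferences with a prescribed expansion -/

theorem tendsto_natCast_add_zpow_neg (v : ℝ) (s : ℕ) :
    Tendsto (fun n : ℕ => ((n : ℝ) + v) ^ (-(s + 1 : ℕ) : ℤ)) atTop (𝓝 0) := by
  have h : Tendsto (fun n : ℕ => (n : ℝ) + v) atTop atTop :=
    tendsto_atTop_add_const_right _ _ tendsto_natCast_atTop_atTop
  exact (tendsto_zpow_atTop_zero (n := (-(s + 1 : ℕ) : ℤ)) (by push_cast; omega)).comp h

/-- Telescoping to infinity, using `x ^ (-2) ≤ 1 / (x - 1) - 1 / x` and bounding the other factor `x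
^ (-s)` by its value at the starting point. -/
theorem norm_le_of_norm_sub_succ_le {v K : ℝ} (hv : 0 ≤ v) (hK : 0 ≤ K) (s : ℕ) {e : ℕ → ℂ}
    (he : Tendsto e atTop (𝓝 0))
    (h : ∀ n : ℕ, 1 ≤ n → ‖e (n + 1) - e n‖ ≤ K * ((n + 1 : ℕ) + v) ^ (-(s + 2 : ℕ) : ℤ))
    {n : ℕ} (hn : 1 ≤ n) : ‖e n‖ ≤ K * (n + v) ^ (-s : ℤ) := by
  have hn' : (1 : ℝ) ≤ n := by exact_mod_cast hn
  have key : ∀ N, n ≤ N →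
      ‖e n‖ ≤ ‖e N‖ + K * (n + v) ^ (-s : ℤ) * (1 / (n + v) - 1 / (N + v)) := by
    intro N hN
    induction N, hN using Nat.le_induction with
    | base => simp
    | succ N hN ih =>
      have hN' : (n : ℝ) ≤ N := by exact_mod_cast hN
      have h1 := h N (hn.trans hN)
      have h2 : ‖e N‖ ≤ ‖e (N + 1)‖ + ‖e (N + 1) - e N‖ := by
        have := norm_sub_le (e (N + 1)) (e (N + 1) - e N)
        simpa using this
      have hpos : 0 < (N : ℝ) + v := by linarith
      have h3 : (((N + 1 : ℕ) : ℝ) + v) ^ (-(s + 2 : ℕ) : ℤ) ≤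
          (n + v) ^ (-s : ℤ) * (1 / (N + v) - 1 / ((N + 1 : ℕ) + v)) := by
        have e1 : (-(s + 2 : ℕ) : ℤ) = -s + -2 := by push_cast; ring
        have hpos' : 0 < ((N + 1 : ℕ) : ℝ) + v := by push_cast; linarith
        rw [e1, zpow_add₀ hpos'.ne']
        have h4 : (((N + 1 : ℕ) : ℝ) + v) ^ (-s : ℤ) ≤ (n + v) ^ (-s : ℤ) := by
          rw [zpow_neg, zpow_neg, zpow_natCast, zpow_natCast]
          apply inv_anti₀ (pow_pos (by linarith) _)
          refine pow_le_pow_left₀ (by linarith) ?_ _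
          push_cast; linarith
        have h5 : (((N + 1 : ℕ) : ℝ) + v) ^ (-2 : ℤ) ≤ 1 / (N + v) - 1 / ((N + 1 : ℕ) + v) := by
          rw [zpow_neg, div_sub_div _ _ hpos.ne' hpos'.ne', inv_eq_one_div,
            div_le_div_iff₀ (by positivity) (by positivity)]
          push_cast
          norm_cast
          push_cast
          nlinarith
        exact mul_le_mul h4 h5 (by positivity) (by positivity)
      have h6 := mul_le_mul_of_nonneg_left h3 hK
      calc ‖e n‖ ≤ _ := ih
        _ ≤ ‖e (N + 1)‖ + K * ((n + v) ^ (-s : ℤ) * (1 / (N + v) - 1 / ((N + 1 : ℕ) + v)))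
            + K * (n + v) ^ (-s : ℤ) * (1 / (n + v) - 1 / (N + v)) := by linarith
        _ = _ := by ring
  have h1 : Tendsto (fun N => ‖e N‖ + K * (n + v) ^ (-s : ℤ)) atTop
      (𝓝 (0 + K * (n + v) ^ (-s : ℤ))) := by
    simpa using he.norm.add_const _
  rw [zero_add] at h1
  refine ge_of_tendsto h1 ?_
  filter_upwards [eventually_ge_atTop n] with N hN
  refine (key N hN).trans (add_le_add_right ?_ _)
  have hN' : (n : ℝ) ≤ N := by exact_mod_cast hN
  have h2 : 1 / ((n : ℝ) + v) ≤ 1 := by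
    rw [div_le_one (by linarith)]; linarith
  have h3 : 0 ≤ 1 / ((N : ℝ) + v) := by
    have : 0 ≤ (N : ℝ) + v := by linarith
    positivity
  exact mul_le_of_le_one_right (mul_nonneg hK (by positivity)) (by linarith)

/-- As in Euler–Maclaurin summation, `U n` is a constant `C w`, playing the role of the regularised
total sum, minus the partial sum of `g`. The constant is fixed by requiring that `U` minus its
expected expansion tend to `0`. -/
theorem exists_antidifference {δ v : ℝ} {M p : ℕ} {g c d : ℕ → ℂ → ℂ} (hv : 0 ≤ v)
    (hpδ : p * δ ≤ 1 / 2) (hc : ∀ i, IsRatOn δ (c i))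
    (hsys : ∀ i w, ‖w‖ ≤ δ →
      ∑ l ∈ Finset.range (i + 1), c l w * shiftCoeff (M + 1) p i l w = d i w)
    (hg : HasExpansion δ v d M p g) (hgd : ∀ n, DifferentiableOn ℂ (g n) (Metric.ball 0 δ)) :
    ∃ U : ℕ → ℂ → ℂ, (∀ n w, U n w - U (n + 1) w = g (n + 1) w) ∧
      (∀ n, DifferentiableOn ℂ (U n) (Metric.ball 0 δ)) ∧ HasExpansion δ v c (M + 1) p U := by
  set E : ℕ → ℕ → ℂ → ℂ := fun L n => expansion c (M + 1) p L (n + v) with hE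
  have hEd : ∀ L n, 1 ≤ n → DifferentiableOn ℂ (E L n) (Metric.ball 0 δ) := fun L n hn => by
    have : (1 : ℝ) ≤ n := by exact_mod_cast hn
    exact differentiableOn_expansion hc (by linarith)
  -- With `M + 3` terms the remainder is `O(n ^ (-2))` uniformly in `w`, so its sum is holomorphic.
  -- The telescoping starts at `n = 1` because `n + v` may vanish at `n = 0`.
  set r : ℕ → ℂ → ℂ := fun n w =>
    g (n + 2) w - (E (M + 3) (n + 1) w - E (M + 3) (n + 2) w) with hr
  obtain ⟨K, hK0, hK⟩ := exists_norm_remainder_le hv hpδ hc hsys hg (M + 3)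
  have hrb : ∀ n w, w ∈ Metric.ball (0 : ℂ) δ → ‖r n w‖ ≤ K * (1 / ((n + 1 : ℕ) : ℝ) ^ 2) := by
    intro n w hw
    have h := hK w (by simpa using hw) (n + 1) (by omega)
    refine h.trans (mul_le_mul_of_nonneg_left ?_ hK0)
    have e1 : ((M : ℤ) + 1 - ((M + 3 : ℕ) : ℤ)) = -(2 : ℕ) := by push_cast; ring
    rw [e1, zpow_neg, zpow_natCast, one_div]
    apply inv_anti₀ (by positivity)
    refine pow_le_pow_left₀ (by positivity) ?_ _
    push_cast; linarith
  have hus : Summable fun n : ℕ => K * (1 / ((n + 1 : ℕ) : ℝ) ^ 2) :=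
    ((summable_nat_add_iff 1).mpr (Real.summable_one_div_nat_pow.mpr one_lt_two)).mul_left K
  have hrd : ∀ n, DifferentiableOn ℂ (r n) (Metric.ball 0 δ) := fun n =>
    (hgd _).sub ((hEd _ _ (by omega)).sub (hEd _ _ (by omega)))
  set G : ℕ → ℂ → ℂ := fun n w => ∑ m ∈ Finset.range n, g (m + 1) w with hG
  set C : ℂ → ℂ := fun w => g 1 w + E (M + 3) 1 w + ∑' n, r n w with hC
  have hCd : DifferentiableOn ℂ C (Metric.ball 0 δ) :=
    ((hgd 1).add (hEd _ _ le_rfl)).add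
      (Complex.differentiableOn_tsum_of_summable_norm hus hrd Metric.isOpen_ball hrb)
  have hlim : ∀ w, ‖w‖ < δ → Tendsto (fun n => C w - G n w - E (M + 3) n w) atTop (𝓝 0) := by
    intro w hw
    have h1 : Summable fun n => r n w :=
      .of_norm_bounded hus fun n => hrb n w (by simpa using hw)
    have h2 : ∀ n, G (n + 1) w + E (M + 3) (n + 1) w =
        g 1 w + E (M + 3) 1 w + ∑ m ∈ Finset.range n, r m w := by
      intro n
      induction n with
      | zero => simp [hG]
      | succ n ih =>
        rw [Finset.sum_range_succ, ← add_assoc, ← ih, hG]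
        simp only [Finset.sum_range_succ _ (n + 1), hr]
        ring
    have h3 := (h1.hasSum.tendsto_sum_nat.const_add (g 1 w + E (M + 3) 1 w)).const_sub (C w)
    rw [hC, sub_self] at h3
    rw [← tendsto_add_atTop_iff_nat 1]
    refine h3.congr fun n => ?_
    rw [← h2, hC]
    ring
  refine ⟨fun n w => C w - G n w, fun n w => ?_, fun n => ?_, fun L => ?_⟩
  · simp only [hG, Finset.sum_range_succ]
    ring
  · exact hCd.sub (DifferentiableOn.fun_sum fun m _ => hgd _)
  -- With `L + M + 3` terms the increments of the error have exponent `-(L + 2)`, so the error is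
  -- `O((n + v) ^ (-L))`; the surplus terms are then dropped.
  · obtain ⟨K₁, hK₁, h₁⟩ := exists_norm_remainder_le hv hpδ hc hsys hg (L + M + 3)
    obtain ⟨K₂, hK₂, h₂⟩ := exists_norm_expansion_sub_le (M := M + 1) hpδ hc
      (show L ≤ L + M + 3 by omega)
    obtain ⟨K₃, hK₃, h₃⟩ := exists_norm_expansion_sub_le (M := M + 1) hpδ hc
      (show M + 3 ≤ L + M + 3 by omega)
    refine ⟨K₁ + K₂, fun w hw n hn => ?_⟩
    have one_le : ∀ n : ℕ, 1 ≤ n → (1 : ℝ) ≤ n + v := fun n hn => by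
      have : (1 : ℝ) ≤ n := by exact_mod_cast hn
      linarith
    have ht : Tendsto (fun n => C w - G n w - E (L + M + 3) n w) atTop (𝓝 0) := by
      have h4 : Tendsto (fun n => E (L + M + 3) n w - E (M + 3) n w) atTop (𝓝 0) := by
        refine squeeze_zero_norm' ?_ (by simpa using (tendsto_natCast_add_zpow_neg v 0).const_mul K₃)
        filter_upwards [eventually_ge_atTop 1] with n hn
        refine (h₃ w hw _ (one_le n hn)).trans_eq ?_
        rw [← zpow_neg_one]
        congr 2
        push_cast; ring
      simpa using (hlim w hw).sub h4
    have h5 := norm_le_of_norm_sub_succ_le hv hK₁ L ht (fun n hn => ?_) hn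
    · have h6 := h₂ w hw _ (one_le n hn)
      have h7 : ((n : ℝ) + v) ^ (-L : ℤ) ≤ (n + v) ^ (((M + 1 : ℕ) : ℤ) + 1 - L) :=
        zpow_le_zpow_right₀ (one_le n hn) (by push_cast; omega)
      calc ‖C w - G n w - expansion c (M + 1) p L (n + v) w‖
          = ‖(C w - G n w - E (L + M + 3) n w) + (E (L + M + 3) n w - E L n w)‖ := by
            congr 1; simp only [hE]; ring
        _ ≤ K₁ * (n + v) ^ (-L : ℤ) + K₂ * (n + v) ^ (((M + 1 : ℕ) : ℤ) + 1 - L) :=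
            (norm_add_le _ _).trans (add_le_add h5 h6)
        _ ≤ _ := by rw [add_mul]; gcongr
    · refine le_trans (le_of_eq ?_) ((h₁ w hw n hn).trans_eq ?_)
      · rw [← norm_neg]
        congr 1
        simp only [hE, hG, Finset.sum_range_succ]
        ring
      · congr 2
        push_cast; ring

/-- `U n w` is, like a regularised tail of a nested sum, holomorphic in `w`, has an asymptotic
expansion as `n → ∞` with coefficients `c`, and is equal to the polynomial part of that expansion
for `w = 0`. -/
structure IsTail (δ v : ℝ) (M p : ℕ) (c U : ℕ → ℂ → ℂ) : Prop where
  expansion : HasExpansion δ v c M p U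
  diff : ∀ n, DifferentiableOn ℂ (U n) (Metric.ball 0 δ)
  value_zero : ∀ n : ℕ, U n 0 = ∑ i ∈ Finset.range (M + 1), c i 0 * ((n + v : ℝ) : ℂ) ^ (M - i)

/-! ### Multiplication of tails by powers, and their summation -/

theorem cpow_mul_expansion (c : ℕ → ℂ → ℂ) (M p A q L : ℕ) {x : ℝ} (hx : 0 < x) (w : ℂ) :
    (x : ℂ) ^ ((A : ℂ) - q * w) * expansion c M p L x w = expansion c (M + A) (p + q) L x w := by
  have hxc : (x : ℂ) ≠ 0 := by exact_mod_cast hx.ne'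
  rw [expansion, expansion, Finset.mul_sum]
  refine Finset.sum_congr rfl fun i _ => ?_
  rw [mul_left_comm, ← Complex.cpow_add _ _ hxc]
  congr 2
  push_cast; ring

theorem HasExpansion.cpow_mul {δ v : ℝ} {M p A q : ℕ} {c U : ℕ → ℂ → ℂ} (hv : 0 ≤ v)
    (hδ : 0 < δ) (hpδ : (p + q : ℕ) * δ ≤ 1 / 2) (hc : ∀ i, IsRatOn δ (c i))
    (hU : HasExpansion δ v c M p U) :
    HasExpansion δ v c (M + A) (p + q)
      fun n w => ((n + v : ℝ) : ℂ) ^ ((A : ℂ) - q * w) * U n w := by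
  intro L
  -- The extra term compensates for the exponent `A + 1`, rather than `A`, in the bound of the
  -- power.
  obtain ⟨K₁, h₁⟩ := hU (L + 1)
  obtain ⟨K₂, hK₂, h₂⟩ := exists_norm_expansion_sub_le (M := M + A) hpδ hc
    (show L ≤ L + 1 by omega)
  refine ⟨K₁ + K₂, fun w hw n hn => ?_⟩
  have hx : (1 : ℝ) ≤ n + v := by
    have : (1 : ℝ) ≤ n := by exact_mod_cast hn
    linarith
  have hqδ : q * δ ≤ 1 / 2 := by
    refine le_trans ?_ hpδ
    gcongr
    omega
  have hA := norm_cpow_exponent_le (M := A) (i := 0) hqδ hx hw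
  simp only [Nat.cast_zero, sub_zero] at hA
  have h3 := h₂ w hw _ hx
  rw [← cpow_mul_expansion c M p A q (L + 1) (by linarith)] at h3
  calc _ = ‖((n + v : ℝ) : ℂ) ^ ((A : ℂ) - q * w) *
          (U n w - _root_.expansion c M p (L + 1) (n + v) w) +
          (((n + v : ℝ) : ℂ) ^ ((A : ℂ) - q * w) * _root_.expansion c M p (L + 1) (n + v) w -
            _root_.expansion c (M + A) (p + q) L (n + v) w)‖ := by congr 1; ring
    _ ≤ (n + v) ^ ((A : ℤ) + 1) * (K₁ * (n + v) ^ ((M : ℤ) + 1 - (L + 1 : ℕ))) +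
        K₂ * (n + v) ^ (((M + A : ℕ) : ℤ) + 1 - L) := by
      refine (norm_add_le _ _).trans (add_le_add ?_ h3)
      rw [norm_mul]
      exact mul_le_mul hA (h₁ w hw n hn) (norm_nonneg _) (by positivity)
    _ = _ := by
      rw [mul_left_comm, ← zpow_add₀ (by linarith), add_mul]
      congr 3
      push_cast; ring

theorem Polynomial.eq_zero_of_tendsto_eval_natCast_add (D : ℂ[X]) (v : ℝ)
    (h : Tendsto (fun n : ℕ => D.eval ((n + v : ℝ) : ℂ)) atTop (𝓝 0)) : D = 0 := by
  rcases lt_or_ge 0 D.degree with hd | hd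
  · have h1 : Tendsto (fun n : ℕ => ‖((n + v : ℝ) : ℂ)‖) atTop atTop := by
      simp only [Complex.norm_real]
      exact tendsto_norm_atTop_atTop.comp
        (tendsto_atTop_add_const_right _ _ tendsto_natCast_atTop_atTop)
    exact absurd h.norm (not_tendsto_nhds_of_tendsto_atTop (D.tendsto_norm_atTop hd h1) _)
  · rw [eq_C_of_degree_le_zero hd] at h ⊢
    simp only [eval_C] at h
    rw [tendsto_nhds_unique tendsto_const_nhds h, C_0]

theorem HasExpansion.tendsto_zero {δ v : ℝ} {M p : ℕ} {c U : ℕ → ℂ → ℂ} (hv : 0 ≤ v)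
    (hδ : 0 < δ) (hc : IsCoeffFamily δ M c) (hU : HasExpansion δ v c M p U) :
    Tendsto (fun n => U n 0 - ∑ i ∈ Finset.range (M + 1), c i 0 * ((n + v : ℝ) : ℂ) ^ (M - i))
      atTop (𝓝 0) := by
  -- The error then has exponent `-1`, and the one additional term `i = M + 1` vanishes at `w = 0`.
  obtain ⟨K, hK⟩ := hU (M + 2)
  refine squeeze_zero_norm' ?_ (by simpa using (tendsto_natCast_add_zpow_neg v 0).const_mul K)
  filter_upwards [eventually_ge_atTop 1] with n hn
  have hx : (0 : ℝ) < n + v := by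
    have : (1 : ℝ) ≤ n := by exact_mod_cast hn
    linarith
  refine le_trans (le_of_eq ?_) ((hK 0 (by simpa using hδ) n hn).trans_eq ?_)
  · rw [_root_.expansion, Finset.sum_range_succ _ (M + 1), hc.vanish (M + 1) (by omega), zero_mul,
      add_zero]
    congr 2
    refine Finset.sum_congr rfl fun i hi => ?_
    have hi' : i ≤ M := by have := Finset.mem_range.mp hi; omega
    have e : (M : ℂ) - i - p * 0 = ((M - i : ℕ) : ℂ) := by push_cast [hi']; ring
    rw [e, Complex.cpow_natCast]
  · rw [← zpow_neg_one]
    congr 2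
    push_cast; ring

/-- The new point is exactness at `w = 0`: a polynomial sequence has a polynomial antidifference,
and the vanishing limit of the error excludes an additive constant. -/
theorem IsTail.exists_succ {δ v : ℝ} {M p A q : ℕ} {c U : ℕ → ℂ → ℂ} (hv : 0 ≤ v) (hδ : 0 < δ)
    (hq : 1 ≤ q) (hpδ : (p + q : ℕ) * δ ≤ 1 / 2) (hc : IsCoeffFamily δ M c)
    (hU : IsTail δ v M p c U) :
    ∃ U' : ℕ → ℂ → ℂ,
      IsTail δ v (M + A + 1) (p + q) (antidiffCoeff (M + A + 1) (p + q) c) U' ∧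
      ∀ n w, U' n w - U' (n + 1) w =
        (((n + 1 : ℕ) + v : ℝ) : ℂ) ^ ((A : ℂ) - q * w) * U (n + 1) w := by
  have hc' : IsCoeffFamily δ (M + A) c := ⟨hc.rat, fun i hi => hc.vanish i (by omega)⟩
  have hcn := isCoeffFamily_antidiffCoeff hδ hpδ hc'
  set c' := antidiffCoeff (M + A + 1) (p + q) c with hcdef
  have hg := hU.expansion.cpow_mul (A := A) hv hδ hpδ hc.rat
  obtain ⟨U', h1, h2, h3⟩ := exists_antidifference (c := c')
    -- For `v = 0` the power at `n = 0` need not be holomorphic in `w`; the recurrence only involves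
    -- `g (n + 1)`.
    (g := fun n w => if n = 0 then 0 else ((n + v : ℝ) : ℂ) ^ ((A : ℂ) - q * w) * U n w)
    hv hpδ hcn.rat
    (fun i w hw => sum_antidiffCoeff_mul_shiftCoeff hδ (by omega) hpδ hc' i hw)
    (fun L => by
      obtain ⟨K, hK⟩ := hg L
      refine ⟨K, fun w hw n hn => ?_⟩
      beta_reduce
      rw [if_neg (by omega)]
      exact hK w hw n hn)
    (fun n => by
      rcases n with _ | n
      · simp only [if_true]; exact differentiableOn_const _
      · simp only [Nat.add_one_ne_zero, if_false]
        refine DifferentiableOn.mul (Differentiable.differentiableOn fun w => ?_) (hU.diff _)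
        refine DifferentiableAt.const_cpow (by fun_prop) (Or.inl ?_)
        have : (0 : ℝ) < (n + 1 : ℕ) + v := by push_cast; positivity
        exact_mod_cast this.ne')
  simp only [Nat.add_one_ne_zero, if_false] at h1
  refine ⟨U', ⟨h3, h2, ?_⟩, h1⟩
  set Q : ℂ[X] := ∑ i ∈ Finset.range (M + 1), C (c i 0) * X ^ (M - i) with hQ
  set Q' : ℂ[X] := ∑ i ∈ Finset.range (M + A + 1 + 1), C (c' i 0) * X ^ (M + A + 1 - i) with hQ'
  have hUQ : ∀ n, U n 0 = Q.eval ((n + v : ℝ) : ℂ) := fun n => by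
    rw [hU.value_zero, hQ, eval_finsetSum]; simp
  have hev : ∀ n : ℕ, ∑ i ∈ Finset.range (M + A + 1 + 1), c' i 0 *
      ((n + v : ℝ) : ℂ) ^ (M + A + 1 - i) = Q'.eval ((n + v : ℝ) : ℂ) := fun n => by
    rw [hQ', eval_finsetSum]; simp
  have ht := h3.tendsto_zero hv hδ hcn
  simp only [hev] at ht ⊢
  -- `D` records the increments of `U' n 0 - Q' (n + v)`. These tend to `0`, so the polynomial `D`
  -- is zero and the error is constant, hence zero even at `n = 0`.
  set D : ℂ[X] := X ^ A * Q - Q'.comp (X - C 1) + Q' with hD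
  have hstep : ∀ n, (U' n 0 - Q'.eval ((n + v : ℝ) : ℂ)) -
      (U' (n + 1) 0 - Q'.eval (((n + 1 : ℕ) + v : ℝ) : ℂ)) =
      D.eval (((n + 1 : ℕ) + v : ℝ) : ℂ) := by
    intro n
    have e := h1 n 0
    rw [mul_zero, sub_zero, Complex.cpow_natCast, hUQ] at e
    have e2 : (((n + 1 : ℕ) + v : ℝ) : ℂ) - 1 = ((n + v : ℝ) : ℂ) := by push_cast; ring
    simp only [hD, eval_add, eval_sub, eval_mul, eval_pow, eval_X, eval_comp, eval_C, e2]
    linear_combination e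
  have hD0 : D = 0 := by
    refine D.eq_zero_of_tendsto_eval_natCast_add v ?_
    rw [← tendsto_add_atTop_iff_nat 1]
    have := ht.sub (ht.comp (tendsto_add_atTop_nat 1))
    rw [sub_zero] at this
    exact this.congr hstep
  have hconst : ∀ n, U' n 0 - Q'.eval ((n + v : ℝ) : ℂ) = U' 0 0 - Q'.eval (((0 : ℕ) + v : ℝ) : ℂ) := by
    intro n
    induction n with
    | zero => rfl
    | succ n ih =>
      have := hstep n
      rw [hD0, eval_zero, sub_eq_zero] at this
      rw [← this, ih]
  intro n
  rw [← sub_eq_zero, hconst n]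
  exact tendsto_nhds_unique (tendsto_const_nhds.congr fun n => (hconst n).symm) ht

theorem isTail_one (δ v : ℝ) (hv : 0 ≤ v) :
    IsTail δ v 0 0 (fun i _ => if i = 0 then 1 else 0) fun _ _ => 1 where
  expansion L := by
    refine ⟨1, fun w _ n hn => ?_⟩
    have hx : (1 : ℝ) ≤ n + v := by
      have : (1 : ℝ) ≤ n := by exact_mod_cast hn
      linarith
    rcases L with _ | L
    · simpa [_root_.expansion] using hx
    · rw [_root_.expansion, Finset.sum_range_succ']
      simp
      positivity
  diff n := differentiableOn_const _
  value_zero n := by simp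

theorem isCoeffFamily_one (δ : ℝ) : IsCoeffFamily δ 0 fun i _ => if i = 0 then 1 else 0 where
  rat i := (IsRatOn.ratCast (if i = 0 then 1 else 0)).congr fun w _ => by split_ifs <;> simp
  vanish i hi := by simp [hi.ne']

/-! ### Calculus of finite parts -/

namespace HasFinitePart

variable {S S' : ℕ → ℂ} {c c' : ℂ}

theorem of_tendsto (h : Tendsto S atTop (𝓝 c)) : HasFinitePart S c :=
  ⟨∅, 0, by simp, by simpa using h.sub_const c⟩

theorem congr' (h : HasFinitePart S c) (e : S =ᶠ[atTop] S') : HasFinitePart S' c := by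
  obtain ⟨s, b, hs, h⟩ := h
  refine ⟨s, b, hs, h.congr' ?_⟩
  filter_upwards [e] with N hN
  rw [hN]

theorem const_mul (a : ℂ) (h : HasFinitePart S c) : HasFinitePart (fun N => a * S N) (a * c) := by
  obtain ⟨s, b, hs, h⟩ := h
  refine ⟨s, fun p => a * b p, hs, ?_⟩
  have := h.const_mul a
  rw [mul_zero] at this
  refine this.congr fun N => ?_
  simp only [mul_sub, Finset.mul_sum, mul_assoc]

theorem add (h : HasFinitePart S c) (h' : HasFinitePart S' c') :
    HasFinitePart (fun N => S N + S' N) (c + c') := by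
  classical
  obtain ⟨s, b, hs, h⟩ := h
  obtain ⟨s', b', hs', h'⟩ := h'
  refine ⟨s ∪ s', fun p => (if p ∈ s then b p else 0) + (if p ∈ s' then b' p else 0),
    by simp [hs, hs'], ?_⟩
  have := h.add h'
  rw [add_zero] at this
  refine this.congr fun N => ?_
  simp only [add_mul, Finset.sum_add_distrib, ite_mul, zero_mul, ← Finset.sum_filter]
  rw [Finset.filter_mem_eq_inter, Finset.filter_mem_eq_inter, Finset.inter_eq_right.mpr
    Finset.subset_union_left, Finset.inter_eq_right.mpr Finset.subset_union_right]
  ring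

theorem sum {ι : Type*} {S : ι → ℕ → ℂ} {c : ι → ℂ} (t : Finset ι)
    (h : ∀ i ∈ t, HasFinitePart (S i) (c i)) :
    HasFinitePart (fun N => ∑ i ∈ t, S i N) (∑ i ∈ t, c i) := by
  classical
  induction t using Finset.induction_on with
  | empty => simpa using of_tendsto tendsto_const_nhds
  | insert a t ha ih =>
    simp only [Finset.sum_insert ha]
    exact (h a (by simp)).add (ih fun i hi => h i (by simp [hi]))

theorem natCast_cpow {α : ℂ} (hα : α ≠ 0) : HasFinitePart (fun N => (N : ℂ) ^ α) 0 :=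
  ⟨{(α, 0)}, fun _ => 1, by simpa using hα.symm, by simp⟩

/-- Binomial expansion in `v / N` gives powers `N ^ (α - r)`, none constant; for `R > re α` the
remainder tends to `0`. -/
theorem natCast_add_cpow {v : ℝ} (hv : 0 ≤ v) {α : ℂ} (hα : ∀ i : ℕ, α - i ≠ 0) :
    HasFinitePart (fun N => ((N + v : ℝ) : ℂ) ^ α) 0 := by
  obtain ⟨R, hR⟩ := exists_nat_gt (α.re)
  obtain ⟨K, hK, H⟩ := exists_norm_one_add_cpow_sub_le ‖α‖ R
  set T : ℕ → ℂ := fun N =>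
    ∑ r ∈ Finset.range R, (Ring.choose α r * (v : ℂ) ^ r) * (N : ℂ) ^ (α - r) with hT
  have h1 : HasFinitePart T 0 := by
    have := sum (Finset.range R) fun r _ =>
      (natCast_cpow (hα r)).const_mul (Ring.choose α r * (v : ℂ) ^ r)
    simpa using this
  have h2 : HasFinitePart (fun N => ((N + v : ℝ) : ℂ) ^ α - T N) 0 := by
    refine of_tendsto (squeeze_zero_norm' (a := fun N : ℕ => K * v ^ R * (N : ℝ) ^ (α.re - R)) ?_ ?_)
    · filter_upwards [eventually_ge_atTop (⌈2 * v⌉₊ + 1)] with N hN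
      have hN0 : (0 : ℝ) < N := by exact_mod_cast (by omega : 0 < N)
      have hNv : 2 * v ≤ N := (Nat.le_ceil _).trans (by exact_mod_cast (by omega : ⌈2 * v⌉₊ ≤ N))
      have hNc : (N : ℂ) ≠ 0 := by exact_mod_cast hN0.ne'
      have e1 : (N + v : ℝ) = N * (1 + v / N) := by field_simp
      have e2 : ((N + v : ℝ) : ℂ) ^ α = (N : ℂ) ^ α * (1 + (v : ℂ) / N) ^ α := by
        rw [e1, Complex.ofReal_mul, Complex.mul_cpow_ofReal_nonneg hN0.le (by positivity)]
        push_cast; rfl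
      have e3 : T N = (N : ℂ) ^ α * ∑ r ∈ Finset.range R, Ring.choose α r * ((v : ℂ) / N) ^ r := by
        rw [hT, Finset.mul_sum]
        refine Finset.sum_congr rfl fun r _ => ?_
        rw [Complex.cpow_sub _ _ hNc, Complex.cpow_natCast, div_pow]
        ring
      have hn : ‖(v : ℂ) / N‖ = v / N := by
        rw [norm_div, Complex.norm_real, Complex.norm_natCast, Real.norm_of_nonneg hv]
      have ht : ‖(v : ℂ) / N‖ ≤ 1 / 2 := by
        rw [hn, div_le_div_iff₀ hN0 two_pos]; linarith
      rw [e2, e3, ← mul_sub, norm_mul, Complex.norm_natCast_cpow_of_pos (by omega)]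
      refine (mul_le_mul_of_nonneg_left (H α le_rfl _ ht) (by positivity)).trans_eq ?_
      rw [hn, div_pow, Real.rpow_sub hN0, Real.rpow_natCast]
      ring
    · have h3 := (tendsto_rpow_neg_atTop (y := R - α.re) (by linarith)).comp
        tendsto_natCast_atTop_atTop
      simpa using h3.const_mul (K * v ^ R)
  simpa using h1.add h2

end HasFinitePart

/-! ### Sequences with an expansion in powers without constant term -/

/-- The span of the sequences `(n + 1 + v) ^ (m - q w)` with `m` an integer and `1 ≤ q ≤ Q`. -/
noncomputable def powSpan (v : ℝ) (w : ℂ) (Q : ℕ) : Submodule ℂ (ℕ → ℂ) :=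
  Submodule.span ℂ {f | ∃ (m : ℤ) (q : ℕ), 1 ≤ q ∧ q ≤ Q ∧
    f = fun n : ℕ => (((n + 1 : ℕ) + v : ℝ) : ℂ) ^ ((m : ℂ) - q * w)}

/-- `S` has an expansion to all orders in powers `(n + v) ^ (m - q w)`, `1 ≤ q ≤ Q`. -/
def HasPowExpansion (v : ℝ) (w : ℂ) (Q : ℕ) (S : ℕ → ℂ) : Prop :=
  ∀ L : ℕ, ∃ T ∈ powSpan v w Q, ∃ K, 0 ≤ K ∧
    ∀ n : ℕ, ‖S (n + 1) - T n‖ ≤ K * ((n + 1 : ℕ) + v) ^ (-L : ℤ)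

theorem powSpan_mono (v : ℝ) (w : ℂ) {Q Q' : ℕ} (h : Q ≤ Q') : powSpan v w Q ≤ powSpan v w Q' :=
  Submodule.span_mono fun _ ⟨m, q, h1, h2, h3⟩ => ⟨m, q, h1, h2.trans h, h3⟩

theorem one_le_succ_add {v : ℝ} (hv : 0 ≤ v) (n : ℕ) : (1 : ℝ) ≤ (n + 1 : ℕ) + v := by
  push_cast
  have : (0 : ℝ) ≤ n := n.cast_nonneg
  linarith

theorem mul_mem_powSpan {v : ℝ} (hv : 0 ≤ v) {w : ℂ} {Q Q' : ℕ} {T T' : ℕ → ℂ}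
    (h : T ∈ powSpan v w Q) (h' : T' ∈ powSpan v w Q') : T * T' ∈ powSpan v w (Q + Q') := by
  have h1 := Submodule.mul_mem_mul h h'
  rw [powSpan, powSpan, Submodule.span_mul_span] at h1
  refine Submodule.span_mono ?_ h1
  rintro _ ⟨_, ⟨m, q, hq, hqQ, rfl⟩, _, ⟨m', q', hq', hqQ', rfl⟩, rfl⟩
  refine ⟨m + m', q + q', by omega, by omega, ?_⟩
  funext n
  have hx : (((n + 1 : ℕ) + v : ℝ) : ℂ) ≠ 0 := by
    exact_mod_cast (zero_lt_one.trans_le (one_le_succ_add hv n)).ne'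
  simp only [Pi.mul_apply]
  rw [← Complex.cpow_add _ _ hx]
  congr 1
  push_cast; ring

theorem exists_norm_le_of_mem_powSpan {v : ℝ} (hv : 0 ≤ v) {w : ℂ} {Q : ℕ} {T : ℕ → ℂ}
    (h : T ∈ powSpan v w Q) :
    ∃ (B : ℕ) (K : ℝ), 0 ≤ K ∧ ∀ n : ℕ, ‖T n‖ ≤ K * ((n + 1 : ℕ) + v) ^ B := by
  induction h using Submodule.span_induction with
  | mem T hT =>
    obtain ⟨m, q, -, -, rfl⟩ := hT
    obtain ⟨B, hB⟩ := exists_nat_ge ((m : ℂ) - q * w).re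
    refine ⟨B, 1, zero_le_one, fun n => ?_⟩
    rw [Complex.norm_cpow_eq_rpow_re_of_pos (zero_lt_one.trans_le (one_le_succ_add hv n)), one_mul,
      ← Real.rpow_natCast]
    exact Real.rpow_le_rpow_of_exponent_le (one_le_succ_add hv n) hB
  | zero => exact ⟨0, 0, le_rfl, fun n => by simp⟩
  | add S T _ _ hS hT =>
    obtain ⟨B, K, hK, h⟩ := hS
    obtain ⟨B', K', hK', h'⟩ := hT
    refine ⟨max B B', K + K', by positivity, fun n => ?_⟩
    have hx := one_le_succ_add hv n
    refine (norm_add_le _ _).trans ?_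
    rw [add_mul]
    refine add_le_add ((h n).trans ?_) ((h' n).trans ?_)
    · gcongr; exact le_max_left _ _
    · gcongr; exact le_max_right _ _
  | smul a T _ hT =>
    obtain ⟨B, K, hK, h⟩ := hT
    refine ⟨B, ‖a‖ * K, by positivity, fun n => ?_⟩
    rw [Pi.smul_apply, norm_smul, mul_assoc]
    gcongr
    exact h n

theorem hasFinitePart_of_mem_powSpan {v : ℝ} (hv : 0 ≤ v) {w : ℂ} {Q : ℕ}
    (hw : ∀ (m : ℤ) (q : ℕ), 1 ≤ q → q ≤ Q → (m : ℂ) - q * w ≠ 0) {T : ℕ → ℂ}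
    (h : T ∈ powSpan v w Q) : HasFinitePart (fun N => T (N - 1)) 0 := by
  induction h using Submodule.span_induction with
  | mem T hT =>
    obtain ⟨m, q, h1, h2, rfl⟩ := hT
    refine (HasFinitePart.natCast_add_cpow hv (α := (m : ℂ) - q * w) fun i hi => ?_).congr' ?_
    · refine hw (m - i) q h1 h2 ?_
      push_cast
      linear_combination hi
    · filter_upwards [eventually_ge_atTop 1] with N hN
      rw [Nat.sub_add_cancel hN]
  | zero => exact .of_tendsto tendsto_const_nhds
  | add S T _ _ hS hT => simpa using hS.add hT
  | smul a T _ hT => simpa using hT.const_mul a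

namespace HasPowExpansion

variable {v : ℝ} {w : ℂ} {Q Q' : ℕ} {S S' : ℕ → ℂ}

theorem mono (h : HasPowExpansion v w Q S) (hQ : Q ≤ Q') : HasPowExpansion v w Q' S := fun L => by
  obtain ⟨T, hT, H⟩ := h L
  exact ⟨T, powSpan_mono v w hQ hT, H⟩

theorem zero : HasPowExpansion v w Q 0 := fun L =>
  ⟨0, zero_mem _, 0, le_rfl, fun n => by simp⟩

theorem add (h : HasPowExpansion v w Q S) (h' : HasPowExpansion v w Q S') :
    HasPowExpansion v w Q (S + S') := fun L => by
  obtain ⟨T, hT, K, hK, H⟩ := h L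
  obtain ⟨T', hT', K', hK', H'⟩ := h' L
  refine ⟨T + T', add_mem hT hT', K + K', by positivity, fun n => ?_⟩
  have e : (S + S') (n + 1) - (T + T') n = (S (n + 1) - T n) + (S' (n + 1) - T' n) := by
    simp only [Pi.add_apply]; ring
  rw [e, add_mul]
  exact (norm_add_le _ _).trans (add_le_add (H n) (H' n))

theorem smul (a : ℂ) (h : HasPowExpansion v w Q S) : HasPowExpansion v w Q (a • S) := fun L => by
  obtain ⟨T, hT, K, hK, H⟩ := h L
  refine ⟨a • T, Submodule.smul_mem _ a hT, ‖a‖ * K, by positivity, fun n => ?_⟩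
  rw [Pi.smul_apply, Pi.smul_apply, ← smul_sub, norm_smul, mul_assoc]
  gcongr
  exact H n

theorem exists_norm_le (hv : 0 ≤ v) (h : HasPowExpansion v w Q S) :
    ∃ (B : ℕ) (K : ℝ), 0 ≤ K ∧ ∀ n : ℕ, ‖S (n + 1)‖ ≤ K * ((n + 1 : ℕ) + v) ^ B := by
  obtain ⟨T, hT, K, hK, H⟩ := h 0
  obtain ⟨B, K', hK', H'⟩ := exists_norm_le_of_mem_powSpan hv hT
  refine ⟨B, K + K', by positivity, fun n => ?_⟩
  have h1 : S (n + 1) = (S (n + 1) - T n) + T n := by ring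
  have h2 : (1 : ℝ) ≤ ((n + 1 : ℕ) + v) ^ B := one_le_pow₀ (one_le_succ_add hv n)
  have h3 := H n
  simp only [Nat.cast_zero, neg_zero, zpow_zero, mul_one] at h3
  rw [h1, add_mul]
  exact (norm_add_le _ _).trans (add_le_add (h3.trans (le_mul_of_one_le_right hK h2)) (H' n))

theorem mul (hv : 0 ≤ v) (h : HasPowExpansion v w Q S) (h' : HasPowExpansion v w Q' S') :
    HasPowExpansion v w (Q + Q') (S * S') := fun L => by
  obtain ⟨B, K₀, hK₀, H₀⟩ := h'.exists_norm_le hv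
  -- The additional orders `B`, and `B'` below, absorb the polynomial growth of the other factor.
  obtain ⟨T, hT, K₁, hK₁, H₁⟩ := h (L + B)
  obtain ⟨B', K₂, hK₂, H₂⟩ := exists_norm_le_of_mem_powSpan hv hT
  obtain ⟨T', hT', K₃, hK₃, H₃⟩ := h' (L + B')
  refine ⟨T * T', mul_mem_powSpan hv hT hT', K₁ * K₀ + K₂ * K₃, by positivity, fun n => ?_⟩
  set x : ℝ := (n + 1 : ℕ) + v with hx
  have hx0 : x ≠ 0 := (zero_lt_one.trans_le (one_le_succ_add hv n)).ne'
  have hxp : 0 < x := zero_lt_one.trans_le (one_le_succ_add hv n)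
  have e : (S * S') (n + 1) - (T * T') n =
      (S (n + 1) - T n) * S' (n + 1) + T n * (S' (n + 1) - T' n) := by
    simp only [Pi.mul_apply]; ring
  have z : ∀ B : ℕ, x ^ (-(L + B : ℕ) : ℤ) * x ^ B = x ^ (-L : ℤ) := fun B => by
    rw [← zpow_natCast, ← zpow_add₀ hx0]
    congr 1
    push_cast; ring
  calc ‖(S * S') (n + 1) - (T * T') n‖
      ≤ K₁ * x ^ (-(L + B : ℕ) : ℤ) * (K₀ * x ^ B) +
        K₂ * x ^ B' * (K₃ * x ^ (-(L + B' : ℕ) : ℤ)) := by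
        rw [e]
        refine (norm_add_le _ _).trans ?_
        rw [norm_mul, norm_mul]
        exact add_le_add
          (mul_le_mul (H₁ n) (H₀ n) (norm_nonneg _) (by positivity))
          (mul_le_mul (H₂ n) (H₃ n) (norm_nonneg _) (by positivity))
    _ = K₁ * K₀ * (x ^ (-(L + B : ℕ) : ℤ) * x ^ B) +
        K₂ * K₃ * (x ^ (-(L + B' : ℕ) : ℤ) * x ^ B') := by ring
    _ = _ := by rw [z, z]; ring

theorem hasFinitePart (hv : 0 ≤ v) (hw : ∀ (m : ℤ) (q : ℕ), 1 ≤ q → q ≤ Q → (m : ℂ) - q * w ≠ 0)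
    (h : HasPowExpansion v w Q S) : HasFinitePart S 0 := by
  obtain ⟨T, hT, K, hK, H⟩ := h 1
  have h1 := hasFinitePart_of_mem_powSpan hv hw hT
  have h2 : HasFinitePart (fun N => S N - T (N - 1)) 0 := by
    refine .of_tendsto (squeeze_zero_norm' ?_
      (by simpa using (tendsto_natCast_add_zpow_neg v 0).const_mul K))
    filter_upwards [eventually_ge_atTop 1] with N hN
    have h3 := H (N - 1)
    rw [Nat.sub_add_cancel hN] at h3
    simpa using h3
  simpa using h1.add h2

end HasPowExpansion

theorem HasExpansion.hasPowExpansion {δ v : ℝ} {M p Q : ℕ} {c U : ℕ → ℂ → ℂ}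
    (hU : HasExpansion δ v c M p U) (hv : 0 ≤ v) (hp : 1 ≤ p) (hpQ : p ≤ Q) {w : ℂ}
    (hw : ‖w‖ < δ) : HasPowExpansion v w Q fun n => U n w := fun L => by
  obtain ⟨K, hK⟩ := hU (L + M + 1)
  refine ⟨fun n => _root_.expansion c M p (L + M + 1) ((n + 1 : ℕ) + v) w, ?_, |K|, abs_nonneg _,
    fun n => ?_⟩
  · have e : (fun n : ℕ => _root_.expansion c M p (L + M + 1) ((n + 1 : ℕ) + v) w) =
        ∑ i ∈ Finset.range (L + M + 1), c i w •
          fun n : ℕ => (((n + 1 : ℕ) + v : ℝ) : ℂ) ^ ((((M : ℤ) - i : ℤ) : ℂ) - p * w) := by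
      funext n
      simp [_root_.expansion, Finset.sum_apply]
    rw [e]
    exact sum_mem fun i _ => Submodule.smul_mem _ _ (Submodule.subset_span ⟨_, p, hp, hpQ, rfl⟩)
  · have hx : (0 : ℝ) ≤ (n + 1 : ℕ) + v := zero_le_one.trans (one_le_succ_add hv n)
    refine (hK w hw (n + 1) (by omega)).trans ?_
    have e : (M : ℤ) + 1 - (L + M + 1 : ℕ) = -L := by push_cast; ring
    rw [e]
    gcongr
    exact le_abs_self K

/-! ### Nested sums of powers -/

/-- The nested sum `∑_{0 < n_k < ⋯ < n₁ ≤ N} ∏ (n_i + v) ^ (A_i - q_i w)` for the list of the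
`(A_i, q_i)`. -/
noncomputable def powNestedSum (v : ℝ) (w : ℂ) : List (ℕ × ℕ) → ℕ → ℂ
  | [], _ => 1
  | a :: l, N => ∑ n ∈ Finset.range N,
      (((n + 1 : ℕ) + v : ℝ) : ℂ) ^ ((a.1 : ℂ) - a.2 * w) * powNestedSum v w l n

/-- The nested sum of powers weighted by `U` at the largest summation index. -/
noncomputable def weightedNestedSum (v : ℝ) (w : ℂ) (U : ℕ → ℂ) : List (ℕ × ℕ) → ℕ → ℂ
  | [], _ => U 0
  | a :: l, N => ∑ n ∈ Finset.range N,
      (((n + 1 : ℕ) + v : ℝ) : ℂ) ^ ((a.1 : ℂ) - a.2 * w) * U (n + 1) * powNestedSum v w l n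

theorem weightedNestedSum_one (v : ℝ) (w : ℂ) (l : List (ℕ × ℕ)) (N : ℕ) :
    weightedNestedSum v w (fun _ => 1) l N = powNestedSum v w l N := by
  cases l <;> simp [weightedNestedSum, powNestedSum]

/-- Summation by parts. -/
theorem weightedNestedSum_cons (v : ℝ) (w : ℂ) {U U' : ℕ → ℂ} (a : ℕ × ℕ) (l : List (ℕ × ℕ))
    (h : ∀ n, U' n - U' (n + 1) =
      (((n + 1 : ℕ) + v : ℝ) : ℂ) ^ ((a.1 : ℂ) - a.2 * w) * U (n + 1)) (N : ℕ) :
    weightedNestedSum v w U (a :: l) N =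
      weightedNestedSum v w U' l N - U' N * powNestedSum v w l N := by
  rw [weightedNestedSum]
  simp only [← h]
  induction N with
  | zero => cases l <;> simp [weightedNestedSum, powNestedSum]
  | succ N ih =>
    rw [Finset.sum_range_succ, ih]
    cases l with
    | nil => simp only [weightedNestedSum, powNestedSum]; ring
    | cons b l => simp only [weightedNestedSum, powNestedSum, Finset.sum_range_succ]; ring

theorem exists_polynomial_of_isCoeffFamily {δ : ℝ} (hδ : 0 < δ) {M : ℕ} {c : ℕ → ℂ → ℂ}
    (hc : IsCoeffFamily δ M c) (h0 : c 0 0 ≠ 0) :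
    ∃ P : ℚ[X], P.degree = (M : WithBot ℕ) ∧ ∀ x : ℂ,
      aeval x P = ∑ i ∈ Finset.range (M + 1), c i 0 * x ^ (M - i) := by
  choose r hr using fun i => (hc.rat i).exists_rat hδ.le
  refine ⟨∑ i ∈ Finset.range (M + 1), C (r i) * X ^ (M - i), ?_, fun x => ?_⟩
  · have hr0 : r 0 ≠ 0 := by
      rintro h
      rw [hr, h, Rat.cast_zero] at h0
      exact h0 rfl
    rw [Finset.sum_range_succ', add_comm, degree_add_eq_left_of_degree_lt]
    · rw [tsub_zero, degree_C_mul_X_pow _ hr0]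
    · rw [tsub_zero, degree_C_mul_X_pow _ hr0]
      refine lt_of_le_of_lt (degree_sum_le _ _) ?_
      rw [Finset.sup_lt_iff (WithBot.bot_lt_coe _)]
      intro i hi
      have hi' := Finset.mem_range.mp hi
      refine (degree_C_mul_X_pow_le _ _).trans_lt ?_
      exact_mod_cast (by omega : M - (i + 1) < M)
  · simp [hr]

/-- Induction on the list, for all weights at once, since summation by parts changes the weight. The
polynomial depends only on `c`, not on `v` or on the tail. -/
theorem exists_weightedNestedSum_expansion {δ : ℝ} (hδ : 0 < δ) (l : List (ℕ × ℕ))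
    (hl : ∀ a ∈ l, 1 ≤ a.2) (M p : ℕ) (c : ℕ → ℂ → ℂ) (hc : IsCoeffFamily δ M c)
    (h0 : c 0 0 ≠ 0) (hpδ : (p + (l.map Prod.snd).sum : ℕ) * δ ≤ 1 / 2) :
    ∃ P : ℚ[X], P.degree = ((M + l.length + (l.map Prod.fst).sum : ℕ) : WithBot ℕ) ∧
      ∀ v : ℝ, 0 ≤ v → ∀ U : ℕ → ℂ → ℂ, IsTail δ v M p c U →
        ∃ K : ℂ → ℂ, DifferentiableOn ℂ K (Metric.ball 0 δ) ∧ K 0 = aeval (v : ℂ) P ∧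
          ∀ w : ℂ, ‖w‖ < δ → HasPowExpansion v w (p + (l.map Prod.snd).sum)
            fun N => weightedNestedSum v w (fun n => U n w) l N - K w := by
  induction l generalizing M p c with
  | nil =>
    obtain ⟨P, hP, hPv⟩ := exists_polynomial_of_isCoeffFamily hδ hc h0
    refine ⟨P, by simpa using hP, fun v hv U hU => ⟨U 0, hU.diff 0, ?_, fun w _ => ?_⟩⟩
    · rw [hU.value_zero, hPv]; simp
    · simp only [weightedNestedSum, sub_self]
      exact .zero
  | cons a l ih =>
    have ha := hl a (by simp)
    have hl' : ∀ b ∈ l, 1 ≤ b.2 := fun b hb => hl b (by simp [hb])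
    simp only [List.map_cons, List.sum_cons, List.length_cons] at hpδ ⊢
    have hq : (p + a.2 : ℕ) * δ ≤ 1 / 2 := le_trans (by gcongr; omega) hpδ
    have hs : (0 + (l.map Prod.snd).sum : ℕ) * δ ≤ 1 / 2 := le_trans (by gcongr <;> omega) hpδ
    have hc' : IsCoeffFamily δ (M + a.1) c := ⟨hc.rat, fun i hi => hc.vanish i (by omega)⟩
    obtain ⟨P, hP, hPv⟩ := ih hl' (M + a.1 + 1) (p + a.2)
      (antidiffCoeff (M + a.1 + 1) (p + a.2) c) (isCoeffFamily_antidiffCoeff hδ hq hc')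
      (by
        rw [antidiffCoeff_zero_zero]
        have : ((M + a.1 : ℕ) : ℂ) + 1 ≠ 0 := by exact_mod_cast Nat.succ_ne_zero (M + a.1)
        exact div_ne_zero (neg_ne_zero.mpr h0) this)
      (by rwa [add_assoc])
    -- A second use, with constant weight `1`, expands the unweighted nested sum in the boundary
    -- term.
    obtain ⟨P', -, hPv'⟩ := ih hl' 0 0 _ (isCoeffFamily_one δ) (by simp) hs
    refine ⟨P, by rw [hP]; congr 1; ring, fun v hv U hU => ?_⟩
    obtain ⟨U', hU', hrec⟩ := hU.exists_succ (A := a.1) hv hδ ha hq hc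
    obtain ⟨K, hK, hK0, hKe⟩ := hPv v hv U' hU'
    obtain ⟨K', -, -, hKe'⟩ := hPv' v hv _ (isTail_one δ v hv)
    refine ⟨K, hK, hK0, fun w hw => ?_⟩
    have h1 := hKe w hw
    have h2 := hU'.expansion.hasPowExpansion hv (by omega) le_rfl hw
    have h3 := hKe' w hw
    simp only [weightedNestedSum_one, zero_add] at h3
    -- With `S` the shorter nested sum, `U' * S = U' * (S - K') + K' * U'`. Every power here has `q
    -- ≥ 1`, so the constant `K` is unaffected.
    have h4 := (h2.mul hv h3).add ((h2.mono (Nat.le_add_right _ (l.map Prod.snd).sum)).smul (K' w))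
    have h5 := h1.add (h4.smul (-1))
    rw [add_assoc] at h5
    convert h5 using 1
    funext N
    rw [weightedNestedSum_cons v w a l (fun n => hrec n w)]
    simp only [Pi.add_apply, Pi.smul_apply, Pi.mul_apply, smul_eq_mul]
    ring

/-- The cut-off nested sums of powers extend holomorphically to `w = 0`, with value there a
polynomial in `v`. -/
theorem exists_powNestedSum_hasFinitePart {δ : ℝ} (hδ : 0 < δ) (l : List (ℕ × ℕ))
    (hl : ∀ a ∈ l, 1 ≤ a.2) (hlδ : (l.map Prod.snd).sum * δ ≤ 1 / 2) :
    ∃ P : ℚ[X], P.degree = ((l.length + (l.map Prod.fst).sum : ℕ) : WithBot ℕ) ∧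
      ∀ v : ℝ, 0 ≤ v → ∃ K : ℂ → ℂ, DifferentiableOn ℂ K (Metric.ball 0 δ) ∧
        K 0 = aeval (v : ℂ) P ∧
        ∀ w : ℂ, w ≠ 0 → ‖w‖ < δ → HasFinitePart (powNestedSum v w l) (K w) := by
  obtain ⟨P, hP, H⟩ := exists_weightedNestedSum_expansion hδ l hl 0 0 _ (isCoeffFamily_one δ)
    (by simp) (by simpa using hlδ)
  refine ⟨P, by simpa using hP, fun v hv => ?_⟩
  obtain ⟨K, hK, hK0, hKe⟩ := H v hv _ (isTail_one δ v hv)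
  refine ⟨K, hK, hK0, fun w hw0 hw => ?_⟩
  have h1 := (hKe w hw).hasFinitePart hv fun m q hq hqQ h => ?_
  · simp only [weightedNestedSum_one] at h1
    simpa using h1.add (.of_tendsto (tendsto_const_nhds (x := K w)))
  -- If `m = q w`, the integer `m` has absolute value at most `1 / 2`, so `m = 0`, which contradicts
  -- `w ≠ 0`.
  · have hqδ : q * ‖w‖ ≤ 1 / 2 := by
      refine le_trans (mul_le_mul (?_ : (q : ℝ) ≤ (l.map Prod.snd).sum) hw.le (norm_nonneg _)
        (Nat.cast_nonneg _)) hlδ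
      exact_mod_cast (by simpa using hqQ : q ≤ (l.map Prod.snd).sum)
    have hq0 : (q : ℂ) ≠ 0 := by exact_mod_cast (by omega : q ≠ 0)
    have h2 : ‖(m : ℂ)‖ ≤ 1 / 2 := by
      rw [sub_eq_zero.mp h, norm_mul, Complex.norm_natCast]; exact hqδ
    rcases eq_or_ne m 0 with rfl | hm
    · simp [hq0, hw0] at h
    · rw [Complex.norm_intCast] at h2
      have : (1 : ℝ) ≤ |(m : ℝ)| := by exact_mod_cast Int.one_le_abs hm
      linarith

/-! ### Nested sums of twisted tensors -/

theorem nestedSum_pureTensor (N : ℕ) {k : ℕ} (f : Fin k → ℝ → ℂ) :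
    nestedSum N (pureTensor f) =
      ∑ n ∈ (Fintype.piFinset fun _ : Fin k => Finset.Icc 1 N).filter StrictAnti,
        ∏ i, f i (n i) := by
  simp [nestedSum, pureTensor]

theorem sum_strictAnti_succ {k : ℕ} (N : ℕ) (F : (Fin (k + 1) → ℕ) → ℂ) :
    ∑ n ∈ (Fintype.piFinset fun _ : Fin (k + 1) => Finset.Icc 1 N).filter StrictAnti, F n =
      ∑ m ∈ Finset.range N,
        ∑ n ∈ (Fintype.piFinset fun _ : Fin k => Finset.Icc 1 m).filter StrictAnti,
          F (Fin.cons (m + 1) n) := by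
  rw [Finset.sum_sigma']
  refine Finset.sum_bij' (fun n _ => ⟨n 0 - 1, Fin.tail n⟩) (fun x _ => Fin.cons (x.1 + 1) x.2)
    ?_ ?_ ?_ ?_ ?_
  · intro n hn
    simp only [Finset.mem_filter, Fintype.mem_piFinset, Finset.mem_Icc] at hn
    simp only [Finset.mem_sigma, Finset.mem_range, Finset.mem_filter, Fintype.mem_piFinset,
      Finset.mem_Icc, Fin.tail]
    have h0 := hn.1 0
    refine ⟨by omega, fun i => ⟨(hn.1 i.succ).1, ?_⟩, fun i j hij => hn.2 (by simpa using hij)⟩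
    have := hn.2 (Fin.succ_pos i)
    omega
  · rintro ⟨m, n⟩ hx
    simp only [Finset.mem_sigma, Finset.mem_range, Finset.mem_filter, Fintype.mem_piFinset,
      Finset.mem_Icc] at hx
    simp only [Finset.mem_filter, Fintype.mem_piFinset, Finset.mem_Icc]
    refine ⟨fun i => ?_, fun i j hij => ?_⟩
    · refine Fin.cases ?_ (fun i => ?_) i
      · simp; omega
      · have := hx.2.1 i
        simp; omega
    · induction j using Fin.cases with
      | zero => simp at hij
      | succ j =>
        induction i using Fin.cases with
        | zero =>
          have := hx.2.1 j
          simp; omega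
        | succ i => simpa using hx.2.2 (by simpa using hij)
  · intro n hn
    simp only [Finset.mem_filter, Fintype.mem_piFinset, Finset.mem_Icc] at hn
    have h0 := hn.1 0
    simp only
    rw [Nat.sub_add_cancel h0.1, Fin.cons_self_tail]
  · rintro ⟨m, n⟩ _
    simp
  · intro n hn
    simp only [Finset.mem_filter, Fintype.mem_piFinset, Finset.mem_Icc] at hn
    have h0 := hn.1 0
    simp only
    rw [Nat.sub_add_cancel h0.1, Fin.cons_self_tail]

theorem nestedSum_pureTensor_eq_powNestedSum (v : ℝ) (w : ℂ) {k : ℕ} (f : Fin k → ℝ → ℂ)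
    (b : Fin k → ℕ × ℕ) (h : ∀ i (n : ℕ), 1 ≤ n →
      f i n = ((n + v : ℝ) : ℂ) ^ (((b i).1 : ℂ) - (b i).2 * w)) (N : ℕ) :
    nestedSum N (pureTensor f) = powNestedSum v w (List.ofFn b) N := by
  rw [nestedSum_pureTensor]
  induction k generalizing N with
  | zero =>
    have : Subsingleton (Fin 0 → ℕ) := inferInstance
    simp [powNestedSum, Finset.filter_true_of_mem, Subsingleton.strictAnti]
  | succ k ih =>
    rw [sum_strictAnti_succ, List.ofFn_succ, powNestedSum]
    refine Finset.sum_congr rfl fun m _ => ?_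
    simp only [Fin.prod_univ_succ, Fin.cons_zero, Fin.cons_succ]
    rw [← Finset.mul_sum, ih _ _ (fun i n hn => h i.succ n hn), h 0 (m + 1) (by omega)]

theorem twistedMap_pureTensor {A : Type*} [CommRing A] [Algebra ℂ A] (R : A →ₗ[ℂ] A) {k : ℕ}
    (u : Fin k → A) :
    twistedMap R (pureTensor u) = ∑ I : Composition k, ∑ J : Composition I.length,
      ((-1) ^ (k - I.length) / ∏ j : Fin I.length, (I.blocksFun j : ℂ)) •
        (1 / ∏ j : Fin J.length, ((J.blocksFun j).factorial : ℂ)) •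
          pureTensor (blockProd J fun i => R (blockProd I u i)) := by
  simp only [twistedMap, LinearMap.comp_apply]
  rw [hoffmanLog, pureTensor, DirectSum.toModule_lof]
  simp only [LinearMap.sum_apply, LinearMap.smul_apply, PiTensorProduct.lift.tprod, map_sum,
    map_smul]
  refine Finset.sum_congr rfl fun I _ => ?_
  rw [← Finset.smul_sum]
  congr 1
  rw [contractBlocks, MultilinearMap.coe_mk, pureTensor, tensorMap, DirectSum.lmap_lof,
    PiTensorProduct.map_tprod, hoffmanExp, DirectSum.toModule_lof]
  simp [contractBlocks]

/-- The exponents `(A, q)` of the blocks obtained by contracting along `I` and then along `J`: in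
each block, `A` is the sum of the entries of `a`, and `q` the number of blocks of `I`. -/
def blockExponents {k : ℕ} (a : Fin k → ℕ) (I : Composition k) (J : Composition I.length)
    (j : Fin J.length) : ℕ × ℕ :=
  (∑ i with J.index i = j, ∑ l with I.index l = i, a l,
    (Finset.univ.filter fun i => J.index i = j).card)

section blockExponents

variable {k : ℕ} (a : Fin k → ℕ) (I : Composition k) (J : Composition I.length)

theorem one_le_blockExponents_snd (j : Fin J.length) : 1 ≤ (blockExponents a I J j).2 := by
  rw [blockExponents, Nat.one_le_iff_ne_zero, Finset.card_ne_zero]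
  exact ⟨J.embedding j ⟨0, J.blocks_pos' _ j.2⟩, by simp [J.index_embedding]⟩

theorem sum_blockExponents_snd : ∑ j, (blockExponents a I J j).2 = I.length := by
  simp only [blockExponents]
  rw [← Finset.card_eq_sum_card_fiberwise (fun _ _ => Finset.mem_univ _)]
  simp

theorem sum_blockExponents_fst : ∑ j, (blockExponents a I J j).1 = ∑ i, a i := by
  simp only [blockExponents]
  rw [Finset.sum_fiberwise, Finset.sum_fiberwise]

/-- The cut-off equals `1` at `n ≥ 1` and drops out. Each block of `I` is regularised once, hence
carries one factor `(n + v) ^ (-w)`. -/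
theorem blockProd_rieszReg_hurwitzSymbol {χ : ℝ → ℝ} (hχ : IsCutoff χ) {v : ℝ} (hv : 0 ≤ v) (w : ℂ)
    (j : Fin J.length) {n : ℕ} (hn : 1 ≤ n) :
    blockProd J (fun i => rieszReg v w
      (blockProd I (fun l => hurwitzSymbol χ v (-(a l : ℂ))) i)) j n =
      ((n + v : ℝ) : ℂ) ^
        (((blockExponents a I J j).1 : ℂ) - (blockExponents a I J j).2 * w) := by
  have hn' : (1 : ℝ) ≤ n := by exact_mod_cast hn
  have hx : ((n + v : ℝ) : ℂ) ≠ 0 := by exact_mod_cast (by linarith : (n : ℝ) + v ≠ 0)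
  have h1 : ∀ l, hurwitzSymbol χ v (-(a l : ℂ)) n = ((n + v : ℝ) : ℂ) ^ a l := fun l => by
    rw [hurwitzSymbol, hχ.eq_one _ hn', neg_neg, Complex.cpow_natCast]
    simp
  simp only [blockProd, rieszReg, Finset.prod_apply, LinearMap.mulRight_apply, Pi.mul_apply, h1]
  rw [Finset.prod_mul_distrib, Finset.prod_const, ← Complex.cpow_nat_mul, mul_neg,
    Complex.cpow_sub _ _ hx, Complex.cpow_natCast, Complex.cpow_neg, div_eq_mul_inv]
  simp only [Finset.prod_pow_eq_pow_sum]
  rfl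

end blockExponents

theorem exists_twistedMap_hasFinitePart (k : ℕ) (a : Fin k → ℕ) :
    ∃ δ > (0 : ℝ), ∃ P : ℚ[X], P.degree = ((k + ∑ i, a i : ℕ) : WithBot ℕ) ∧
      ∀ v : ℝ, 0 ≤ v → ∃ K : ℂ → ℂ, DifferentiableOn ℂ K (Metric.ball 0 δ) ∧
        K 0 = aeval (v : ℂ) P ∧
        ∀ χ : ℝ → ℝ, IsCutoff χ → ∀ w : ℂ, w ≠ 0 → ‖w‖ < δ →
          HasCutoffNestedSum (twistedMap (rieszReg v w)
            (pureTensor fun i => hurwitzSymbol χ v (-(a i : ℂ)))) (K w) := by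
  -- The `q` add up to `I.length ≤ k`, so this radius serves all pairs `(I, J)`; `k + 1` avoids
  -- division by zero.
  set δ : ℝ := 1 / (2 * (k + 1)) with hδdef
  have hδ : 0 < δ := by positivity
  have hkδ : (k : ℝ) * δ ≤ 1 / 2 := by
    rw [hδdef, mul_one_div, div_le_div_iff₀ (by positivity) two_pos]; linarith
  choose P hP hPv using fun (I : Composition k) (J : Composition I.length) =>
    exists_powNestedSum_hasFinitePart hδ (List.ofFn (blockExponents a I J))
      (by
        simp only [List.mem_ofFn]
        rintro _ ⟨j, rfl⟩
        exact one_le_blockExponents_snd a I J j)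
      (by
        rw [List.map_ofFn, List.sum_ofFn]
        simp only [Function.comp_apply, sum_blockExponents_snd]
        refine le_trans ?_ hkδ
        gcongr
        exact I.length_le)
  simp only [List.length_ofFn, List.map_ofFn, List.sum_ofFn, Function.comp_apply,
    sum_blockExponents_fst] at hP
  set r : ∀ I : Composition k, Composition I.length → ℚ := fun I J =>
    ((-1) ^ (k - I.length) / ∏ j : Fin I.length, (I.blocksFun j : ℚ)) *
      (1 / ∏ j : Fin J.length, ((J.blocksFun j).factorial : ℚ)) with hr
  refine ⟨δ, hδ, ∑ I, ∑ J, C (r I J) * P I J, ?_, fun v hv => ?_⟩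
  · refine le_antisymm ?_ (le_degree_of_ne_zero ?_)
    · refine (degree_sum_le _ _).trans <| Finset.sup_le fun I _ =>
        (degree_sum_le _ _).trans <| Finset.sup_le fun J _ => ?_
      rw [← smul_eq_C_mul]
      refine (degree_smul_le _ _).trans ?_
      rw [hP]
      have := J.length_le.trans I.length_le
      exact_mod_cast (by omega)
    -- Only `J.length = k` reaches the top degree, which forces `I` and `J` to consist of ones; no
    -- cancellation is possible.
    · have hz : ∀ (I : Composition k) (J : Composition I.length), J.length ≠ k →
          (C (r I J) * P I J).coeff (k + ∑ i, a i) = 0 := by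
        intro I J h
        rw [coeff_C_mul, coeff_eq_zero_of_degree_lt, mul_zero]
        rw [hP]
        have := J.length_le.trans I.length_le
        exact_mod_cast (by omega)
      rw [finsetSum_coeff, Finset.sum_eq_single (Composition.ones k)]
      · rw [finsetSum_coeff, Finset.sum_eq_single (Composition.ones _)]
        · rw [coeff_C_mul]
          refine mul_ne_zero ?_ (coeff_ne_zero_of_eq_degree ?_)
          · simp only [hr]
            refine mul_ne_zero (div_ne_zero (by simp) ?_) (div_ne_zero one_ne_zero ?_)
            · exact Finset.prod_ne_zero_iff.mpr fun j _ => by simp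
            · exact Finset.prod_ne_zero_iff.mpr fun j _ => by simp
          · rw [hP]
            simp
        · intro J _ hJ
          refine hz _ J fun h => hJ ?_
          rw [Composition.eq_ones_iff_length, h, Composition.ones_length]
        · simp
      · intro I _ hI
        rw [finsetSum_coeff]
        refine Finset.sum_eq_zero fun J _ => hz I J fun h => hI ?_
        rw [Composition.eq_ones_iff_length]
        exact le_antisymm I.length_le (h.symm.le.trans J.length_le)
      · simp
  · choose K hK hK0 hKf using fun I J => hPv I J v hv
    refine ⟨fun w => ∑ I, ∑ J, (r I J : ℂ) * K I J w, ?_, ?_, fun χ hχ w hw0 hw => ?_⟩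
    · exact DifferentiableOn.fun_sum fun I _ => DifferentiableOn.fun_sum fun J _ =>
        (hK I J).const_mul _
    · simp [hK0]
    · have h := HasFinitePart.sum Finset.univ fun (I : Composition k) _ =>
        HasFinitePart.sum Finset.univ fun (J : Composition I.length) _ =>
          (hKf I J w hw0 hw).const_mul (r I J : ℂ)
      refine h.congr' (Eventually.of_forall fun N => ?_)
      simp only [twistedMap_pureTensor, map_sum, map_smul, smul_eq_mul]
      refine Finset.sum_congr rfl fun I _ => Finset.sum_congr rfl fun J _ => ?_
      rw [nestedSum_pureTensor_eq_powNestedSum v w _ (blockExponents a I J)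
        fun j n hn => blockProd_rieszReg_hurwitzSymbol a I J hχ hv w j hn, ← mul_assoc]
      simp [hr]

/-! ### The Birkhoff decomposition of a holomorphic map -/

/-- A non-constant polynomial in `z⁻¹` is unbounded near `0`. -/
theorem eq_zero_of_eval_inv_add_analyticAt_eq {p : ℂ[X]} (hp : p.coeff 0 = 0) {f : ℂ → ℂ}
    (hf : ContinuousAt f 0) (h : ∀ᶠ z in 𝓝[≠] (0 : ℂ), p.eval z⁻¹ = f z) : p = 0 := by
  have h1 : Tendsto (fun z : ℂ => p.eval z⁻¹) (𝓝[≠] 0) (𝓝 (f 0)) :=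
    (hf.tendsto.mono_left nhdsWithin_le_nhds).congr' (h.mono fun z hz => hz.symm)
  rcases lt_or_ge 0 p.degree with hd | hd
  · have h2 : Tendsto (fun z : ℂ => ‖z⁻¹‖) (𝓝[≠] 0) atTop := by
      exact tendsto_norm_cobounded_atTop.comp Filter.tendsto_inv₀_nhdsNE_zero
    exact absurd h1.norm (not_tendsto_nhds_of_tendsto_atTop (p.tendsto_norm_atTop hd h2) _)
  · rw [eq_C_of_degree_le_zero hd, hp, C_0]

/-- The chosen pole part is zero by uniqueness, and the default value is zero as well. -/
theorem polePart_eq_zero {f F : ℂ → ℂ} (hF : AnalyticAt ℂ F 0) (h : ∀ᶠ z in 𝓝[≠] 0, f z = F z) :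
    polePart f = 0 := by
  rw [polePart]
  split_ifs with H
  · obtain ⟨hp, g, hg, hfg⟩ := H.choose_spec
    have h0 : H.choose = 0 := by
      refine eq_zero_of_eval_inv_add_analyticAt_eq hp (f := fun z => F z - g z)
        (hF.sub hg).continuousAt ?_
      filter_upwards [h, hfg] with z h1 h2
      rw [← h1, h2]; ring
    funext z
    rw [h0]
    simp
  · rfl

section Birkhoff

variable {A : Type*} {Ψ : List A → ℂ → ℂ} {p : A → Prop}

theorem birkhoff_sum_eq_zero {w : List A}
    (h : ∀ i ∈ Finset.Ico 1 w.length, birkhoffNeg Ψ (w.take i) = 0) (z : ℂ) :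
    ∑ i ∈ Finset.Ico 1 w.length, birkhoffNeg Ψ (w.take i) z * Ψ (w.drop i) z = 0 :=
  Finset.sum_eq_zero fun i hi => by rw [h i hi, Pi.zero_apply, zero_mul]

/-- If `Ψ` is holomorphic at `0` on the words in certain letters, then the negative part of its
Birkhoff decomposition vanishes on the non-empty words in these letters. -/
theorem birkhoffNeg_eq_zero
    (h : ∀ w : List A, (∀ x ∈ w, p x) →
      ∃ F : ℂ → ℂ, AnalyticAt ℂ F 0 ∧ ∀ᶠ z in 𝓝[≠] 0, Ψ w z = F z)
    (w : List A) (hp : ∀ x ∈ w, p x) (hw : w ≠ []) : birkhoffNeg Ψ w = 0 := by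
  induction hn : w.length using Nat.strong_induction_on generalizing w with
  | _ n ih =>
    obtain ⟨F, hF, hΨ⟩ := h w hp
    rw [birkhoffNeg, if_neg hw, neg_eq_zero]
    refine polePart_eq_zero hF (hΨ.mono fun z hz => ?_)
    rw [hz, Finset.sum_attach (Finset.Ico 1 w.length)
      fun i => birkhoffNeg Ψ (w.take i) z * Ψ (w.drop i) z, birkhoff_sum_eq_zero, add_zero]
    intro i hi
    have hi := Finset.mem_Ico.mp hi
    have hl : (w.take i).length = i := by rw [List.length_take]; omega
    exact ih i (by omega) (w.take i) (fun x hx => hp x (List.mem_of_mem_take hx))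
      (by rw [← List.length_pos_iff]; omega) hl

/-- In the situation of `birkhoffNeg_eq_zero`, the positive part of the Birkhoff decomposition is
equal to `Ψ`. -/
theorem birkhoffPos_eq
    (h : ∀ w : List A, (∀ x ∈ w, p x) →
      ∃ F : ℂ → ℂ, AnalyticAt ℂ F 0 ∧ ∀ᶠ z in 𝓝[≠] 0, Ψ w z = F z)
    (w : List A) (hp : ∀ x ∈ w, p x) (hw : w ≠ []) : birkhoffPos Ψ w = Ψ w := by
  obtain ⟨F, hF, hΨ⟩ := h w hp
  have h0 : ∀ z, ∑ i ∈ Finset.Ico 1 w.length,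
      birkhoffNeg Ψ (w.take i) z * Ψ (w.drop i) z = 0 := birkhoff_sum_eq_zero fun i hi => by
    have hi := Finset.mem_Ico.mp hi
    refine birkhoffNeg_eq_zero h _ (fun x hx => hp x (List.mem_of_mem_take hx)) ?_
    rw [← List.length_pos_iff, List.length_take]
    omega
  rw [birkhoffPos, if_neg hw]
  simp only [h0, add_zero]
  rw [polePart_eq_zero hF hΨ, sub_zero]

end Birkhoff

/-! ### Renormalised Hurwitz multiple zeta values at nonpositive integers -/

theorem pureTensor_congr {A : Type*} [CommRing A] [Algebra ℂ A] {m k : ℕ} (h : m = k)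
    {f : Fin m → A} {g : Fin k → A} (hfg : ∀ i, f i = g (i.cast h)) :
    pureTensor f = pureTensor g := by
  subst h
  exact congrArg pureTensor (funext hfg)

/-- Needed for `k = 0`, where `Ψ₊` is `1` by definition and has to be compared with the regularised
sum. -/
theorem nestedSum_twistedMap_zero (R : (ℝ → ℂ) →ₗ[ℂ] (ℝ → ℂ)) (u : Fin 0 → ℝ → ℂ) (N : ℕ) :
    nestedSum N (twistedMap R (pureTensor u)) = 1 := by
  have h1 : ∀ {k : ℕ} (_ : k = 0) (f : Fin k → ℝ → ℂ), nestedSum N (pureTensor f) = 1 := by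
    rintro _ rfl f
    rw [nestedSum_pureTensor_eq_powNestedSum 0 0 f (fun _ => (0, 0)) fun i => i.elim0]
    simp [powNestedSum]
  rw [twistedMap_pureTensor, Finset.sum_eq_single (Composition.ones 0),
    Finset.sum_eq_single (Composition.ones _)]
  · simp [h1]
  · intro J _ hJ
    refine absurd ?_ hJ
    rw [Composition.eq_ones_iff_le_length]
    simp
  · simp
  · intro I _ hI
    refine absurd ?_ hI
    rw [Composition.eq_ones_iff_le_length]
    simp
  · simp

/-- Since `γ` has derivative `1` at its zero `0`, it takes small nonzero values on a punctured
neighbourhood. The value `K (γ 0) = K 0` does not depend on `γ`. -/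
theorem analyticAt_comp_and_eventually_hasCutoffNestedSum {k : ℕ} {a : Fin k → ℕ} {v δ : ℝ}
    (hδ : 0 < δ) {K : ℂ → ℂ} (hK : DifferentiableOn ℂ K (Metric.ball 0 δ)) {χ : ℝ → ℝ}
    (h : ∀ w : ℂ, w ≠ 0 → ‖w‖ < δ → HasCutoffNestedSum (twistedMap (rieszReg v w)
      (pureTensor fun i => hurwitzSymbol χ v (-(a i : ℂ)))) (K w))
    {γ : ℂ → ℂ} (hγ : AnalyticAt ℂ γ 0) (hγ0 : γ 0 = 0) (hγ1 : HasDerivAt γ 1 0) :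
    AnalyticAt ℂ (fun z => K (γ z)) 0 ∧ ∀ᶠ z in 𝓝[≠] (0 : ℂ), HasCutoffNestedSum
      (twistedMap (rieszReg v (γ z)) (pureTensor fun i => hurwitzSymbol χ v (-(a i : ℂ))))
      (K (γ z)) := by
  refine ⟨AnalyticAt.fun_comp (by
    rw [hγ0]; exact hK.analyticAt (Metric.ball_mem_nhds 0 hδ)) hγ, ?_⟩
  have h1 : ∀ᶠ z in 𝓝 (0 : ℂ), ‖γ z‖ < δ := by
    have : Tendsto (fun z => ‖γ z‖) (𝓝 0) (𝓝 0) := by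
      simpa [hγ0] using hγ.continuousAt.norm.tendsto
    exact this.eventually_lt_const hδ
  filter_upwards [hγ1.eventually_ne one_ne_zero (c := 0), h1.filter_mono nhdsWithin_le_nhds]
    with z hz1 hz2
  exact h _ hz1 hz2

theorem exists_analyticAt_regularisedSum {v : ℝ} (hv : 0 ≤ v) {χ : ℝ → ℝ} (hχ : IsCutoff χ)
    {γ : ℂ → ℂ} (hγ : AnalyticAt ℂ γ 0) (hγ0 : γ 0 = 0) (hγ1 : HasDerivAt γ 1 0)
    (w : List (ℝ → ℂ)) (hw : ∀ f ∈ w, ∃ a : ℕ, f = hurwitzSymbol χ v (-(a : ℂ))) :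
    ∃ F : ℂ → ℂ, AnalyticAt ℂ F 0 ∧
      ∀ᶠ z in 𝓝[≠] 0, regularisedSum (fun z => rieszReg v (γ z)) w z = F z := by
  choose a ha using fun i : Fin w.length => hw (w.get i) (List.get_mem _ _)
  obtain ⟨δ, hδ, P, -, H⟩ := exists_twistedMap_hasFinitePart w.length a
  obtain ⟨K, hK, -, hKf⟩ := H v hv
  obtain ⟨h1, h2⟩ := analyticAt_comp_and_eventually_hasCutoffNestedSum hδ hK (hKf χ hχ) hγ hγ0 hγ1
  refine ⟨_, h1, h2.mono fun z hz => ?_⟩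
  rw [regularisedSum, show w.get = fun i => hurwitzSymbol χ v (-(a i : ℂ)) from funext ha]
  exact HasFinitePart.finitePart_eq hz

theorem mainTheorem1 (k : ℕ) (a : Fin k → ℕ) :
    (∃ P : ℚ[X], P.degree = ((k + ∑ i, a i : ℕ) : WithBot ℕ) ∧
      ∀ (v : ℝ), 0 ≤ v → ∀ (χ : ℝ → ℝ), IsCutoff χ →
      ∀ (γ : ℂ → ℂ), AnalyticAt ℂ γ 0 → γ 0 = 0 → HasDerivAt γ 1 0 →
        (∃ F : ℂ → ℂ, AnalyticAt ℂ F 0 ∧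
          (∀ᶠ z in 𝓝[≠] (0 : ℂ), HasCutoffNestedSum
            (twistedMap (rieszReg v (γ z))
              (pureTensor fun i => hurwitzSymbol χ v (-(a i : ℂ)))) (F z)) ∧
          F 0 = aeval (v : ℂ) P) ∧
        HasRenormalisedNestedSum (fun z => rieszReg v (γ z))
          (List.ofFn fun i => hurwitzSymbol χ v (-(a i : ℂ))) (aeval (v : ℂ) P)) ∧
    (∃ q : ℚ, ∀ (χ : ℝ → ℝ), IsCutoff χ →
      ∀ (γ : ℂ → ℂ), AnalyticAt ℂ γ 0 → γ 0 = 0 → HasDerivAt γ 1 0 →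
        HasRenormalisedNestedSum (fun z => rieszReg 0 (γ z))
          (List.ofFn fun i => hurwitzSymbol χ 0 (-(a i : ℂ))) (q : ℂ)) := by
  obtain ⟨δ, hδ, P, hP, H⟩ := exists_twistedMap_hasFinitePart k a
  have main : ∀ (v : ℝ), 0 ≤ v → ∀ (χ : ℝ → ℝ), IsCutoff χ →
      ∀ (γ : ℂ → ℂ), AnalyticAt ℂ γ 0 → γ 0 = 0 → HasDerivAt γ 1 0 →
        (∃ F : ℂ → ℂ, AnalyticAt ℂ F 0 ∧
          (∀ᶠ z in 𝓝[≠] (0 : ℂ), HasCutoffNestedSum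
            (twistedMap (rieszReg v (γ z))
              (pureTensor fun i => hurwitzSymbol χ v (-(a i : ℂ)))) (F z)) ∧
          F 0 = aeval (v : ℂ) P) ∧
        HasRenormalisedNestedSum (fun z => rieszReg v (γ z))
          (List.ofFn fun i => hurwitzSymbol χ v (-(a i : ℂ))) (aeval (v : ℂ) P) := by
    intro v hv χ hχ γ hγ hγ0 hγ1
    obtain ⟨K, hK, hK0, hKf⟩ := H v hv
    obtain ⟨h1, h2⟩ :=
      analyticAt_comp_and_eventually_hasCutoffNestedSum hδ hK (hKf χ hχ) hγ hγ0 hγ1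
    have hF0 : K (γ 0) = aeval (v : ℂ) P := by rw [hγ0, hK0]
    refine ⟨⟨_, h1, h2, hF0⟩, ?_⟩
    set w := List.ofFn fun i => hurwitzSymbol χ v (-(a i : ℂ)) with hw
    have hlim : Tendsto (regularisedSum (fun z => rieszReg v (γ z)) w) (𝓝[≠] 0)
        (𝓝 (aeval (v : ℂ) P)) := by
      rw [← hF0]
      refine (h1.continuousAt.tendsto.mono_left nhdsWithin_le_nhds).congr' ?_
      filter_upwards [h2] with z hz
      rw [regularisedSum, pureTensor_congr (g := fun i => hurwitzSymbol χ v (-(a i : ℂ)))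
        List.length_ofFn (by simp [hw, Fin.cast])]
      exact (HasFinitePart.finitePart_eq hz).symm
    rw [HasRenormalisedNestedSum]
    rcases eq_or_ne w [] with h | h
    · have hk : k = 0 := by simpa [hw] using congrArg List.length h
      subst hk
      rw [h] at hlim ⊢
      refine hlim.congr fun z => ?_
      rw [birkhoffPos, if_pos rfl, Pi.one_apply, regularisedSum, cutoffNestedSum]
      refine HasFinitePart.finitePart_eq (.of_tendsto ?_)
      exact tendsto_const_nhds.congr fun N => (nestedSum_twistedMap_zero _ _ N).symm
    · rw [birkhoffPos_eq (p := fun f => ∃ a : ℕ, f = hurwitzSymbol χ v (-(a : ℂ)))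
        (fun u hu => exists_analyticAt_regularisedSum hv hχ hγ hγ0 hγ1 u hu) w ?_ h]
      · exact hlim
      · rw [hw]
        simp only [List.mem_ofFn]
        rintro _ ⟨i, rfl⟩
        exact ⟨a i, rfl⟩
  -- At `v = 0` the value `P(0)` is the constant coefficient, a rational number.
  refine ⟨⟨P, hP, main⟩, P.coeff 0, fun χ hχ γ hγ hγ0 hγ1 => ?_⟩
  have h := (main 0 le_rfl χ hχ γ hγ hγ0 hγ1).2
  rw [Complex.ofReal_zero, ← coeff_zero_eq_aeval_zero'] at h
  simpa using h
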